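/- Let $M\rightarrow N$ be an oriented matroid perspective on a finite linearly ordered set $E$; that is, $M$ and $N$ are oriented matroids on $E$ and every circuit of $M$ is a vector of $N$ (a conformal union of circuits of $N$). Let $$t(M,N;x,y,z)=\sum_{A\subseteq E}(x-1)^{r(N)-r_N(A)}\,(y-1)^{|A|-r_M(A)}\,z^{\,r(M)-r(N)-(r_M(A)-r_N(A))}$$ be its Tutte polynomial, and let $t_{i,j}$ be the coefficient of $x^iy^j$ in $t(M,N;x,y,1)$. For an oriented matroid $L$ on $E$ let $O(L)$ (the active elements) be the set of smallest elements of positive circuits of $L$, and $O^*(L)$ (the dual-active elements) the set of smallest elements of positive cocircuits of $L$. For $a\in O(L)$ (resp. $a\in O^*(L)$) the cyclic part (resp. acyclic part) $L_a$ of $a$ is the union of the positive circuits (resp. positive cocircuits) of $L$ with smallest element $\geq a$, minus the union of those with smallest element $>a$. The reorientations $-_AM\rightarrow -_AN$ of $M\rightarrow N$ are indexed by the subsets $A\subseteq E$ (two different subsets count as two reorientations). The active, resp. dual-active, elements of $-_AM\rightarrow -_AN$ are those in $O(-_AM)$, resp. in $O^*(-_AN)$. The activity class of $-_AM\rightarrow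 -_AN$ is the set of reorientations given by the subsets $$A\,\triangle\Bigl(\bigcup_{a\in P}(-_AN)_a\ \cup\ \bigcup_{a\in Q}(-_AM)_a\Bigr),\qquad P\subseteq O^*(-_AN),\quad Q\subseteq O(-_AM),$$ where acyclic parts are used for $a\in P$ and cyclic parts for $a\in Q$. Call $-_AM$ active-fixed if $O(-_AM)\cap A=\emptyset$, and $-_AN$ dual-active-fixed if $O^*(-_AN)\cap A=\emptyset$. An oriented matroid is acyclic if it has no positive circuit, and totally cyclic if each element is in a positive circuit. An activity class is said to have a property if all the reorientations in it have it. Then, for all $i,j\geq 0$, $t_{i,j}$ equals the number of activity classes of reorientations of $M\rightarrow N$ with $i$ dual-active and $j$ active elements. Equally, $t_{i,j}$ equals the number of reorientations $-_AM\rightarrow -_AN$ with $i$ dual-active and $j$ active elements for which $-_AM$ is active-fixed and $-_AN$ is dual-active-fixed. Furthermore: 1. $t(M,N;2,2,1)$ is the number of all reorientations; 2. $t(M,N;2,0,1)$ is the number of reorientations with $-_AM$ acyclic; 3. $t(M,N;0,2,1)$ is the number of reorientations with $-_AN$ totally cyclic; 4. $t(M,N;1,0,1)$ is the number of reorientations with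 $-_AM$ acyclic and $-_AN$ dual-active-fixed, and also the number of activity classes with $-_AM$ acyclic; 5. $t(M,N;0,1,1)$ is the number of reorientations with $-_AM$ active-fixed and $-_AN$ totally cyclic, and also the number of activity classes with $-_AN$ totally cyclic; 6. $t(M,N;2,1,1)$ is the number of reorientations with $-_AM$ active-fixed; 7. $t(M,N;1,2,1)$ is the number of reorientations with $-_AN$ dual-active-fixed; 8. $t(M,N;1,1,1)$ is the number of reorientations with $-_AM$ active-fixed and $-_AN$ dual-active-fixed, and also the total number of activity classes; 9. $t(M,N;0,0,1)$ is the number of reorientations with $-_AM$ acyclic and $-_AN$ totally cyclic, and also the number of activity classes with $-_AM$ acyclic and $-_AN$ totally cyclic. -/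

import Mathlib

/-- A signed subset of `E`: the elements with sign `1` are its positive elements, those with
sign `-1` its negative elements. -/
abbrev SignedSet (E : Type*) := E → SignType

namespace SignedSet

variable {E : Type*}

/-- `X` is positive: it has no negative element. -/
def IsPositive (X : SignedSet E) : Prop := ∀ e, 0 ≤ X e

/-- `X` and `Y` are orthogonal: their supports are disjoint, or they agree somewhere and
disagree somewhere on the intersection of their supports. -/
def Orthogonal (X Y : SignedSet E) : Prop :=
  (∀ e, X e * Y e = 0) ∨ ((∃ e, X e * Y e = 1) ∧ (∃ e, X e * Y e = -1))

/-- Reversing the signs of the elements of `A`. -/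
def reorient [DecidableEq E] (A : Finset E) (X : SignedSet E) : SignedSet E :=
  fun e => if e ∈ A then -X e else X e

end SignedSet

/-- An oriented matroid on the ground set `E`, given by its signed circuits. -/
@[ext]
structure OrientedMatroid (E : Type*) where
  /-- The set of signed circuits. -/
  circuits : Set (SignedSet E)
  zero_notMem : (0 : SignedSet E) ∉ circuits
  neg_mem : ∀ X ∈ circuits, -X ∈ circuits
  eq_or_eq_neg : ∀ X ∈ circuits, ∀ Y ∈ circuits,
    Function.support X ⊆ Function.support Y → X = Y ∨ X = -Y
  /-- Weak circuit elimination. -/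
  elimination : ∀ X ∈ circuits, ∀ Y ∈ circuits, X ≠ -Y → ∀ e, X e ≠ 0 → X e = -Y e →
    ∃ Z ∈ circuits, Z e = 0 ∧ ∀ f, Z f ≠ 0 → Z f = X f ∨ Z f = Y f

namespace OrientedMatroid

section Basic

variable {E : Type*}

/-- `I` contains the support of no circuit. -/
def Independent (M : OrientedMatroid E) (I : Set E) : Prop :=
  ∀ X ∈ M.circuits, ¬ Function.support X ⊆ I

theorem exists_support_subset (M : OrientedMatroid E) {X Y : SignedSet E}
    (hX : X ∈ M.circuits) (hY : Y ∈ M.circuits)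
    (hne : Function.support X ≠ Function.support Y) {e : E} (heX : X e ≠ 0) (heY : Y e ≠ 0) :
    ∃ Z ∈ M.circuits,
      Function.support Z ⊆ (Function.support X ∪ Function.support Y) \ {e} := by
  have key : ∀ Y' ∈ M.circuits, Function.support Y' = Function.support Y → X e = -Y' e →
      ∃ Z ∈ M.circuits,
        Function.support Z ⊆ (Function.support X ∪ Function.support Y) \ {e} := by
    intro Y' hY' hs hXe
    have hXY : X ≠ -Y' := by
      intro h
      apply hne
      rw [← hs, h]
      ext f
      simp
    obtain ⟨Z, hZ, hZe, hZf⟩ := M.elimination X hX Y' hY' hXY e heX hXe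
    refine ⟨Z, hZ, fun f hf => ⟨?_, ?_⟩⟩
    · rw [← hs]
      rcases hZf f hf with h | h
      · exact Or.inl (by rw [Function.mem_support, ← h]; exact hf)
      · exact Or.inr (by rw [Function.mem_support, ← h]; exact hf)
    · rintro rfl
      exact hf hZe
  have hcases : X e = -Y e ∨ X e = Y e := by
    revert heX heY
    generalize X e = a
    generalize Y e = b
    revert a b
    decide
  rcases hcases with h | h
  · exact key Y hY rfl h
  · refine key (-Y) (M.neg_mem Y hY) ?_ (by simpa using h)
    ext f
    simp

theorem Independent.augment [Finite E] (M : OrientedMatroid E) {I J : Set E}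
    (hI : M.Independent I) (hJ : M.Independent J) (hlt : I.ncard < J.ncard) :
    ∃ e ∈ J, e ∉ I ∧ M.Independent (insert e I) := by
  by_contra hcon
  push Not at hcon
  obtain ⟨K, ⟨hKsub, hKind, hKcard⟩, hKmin⟩ :=
    Set.exists_min_image {K : Set E | K ⊆ I ∪ J ∧ M.Independent K ∧ I.ncard < K.ncard}
      (fun K => (I \ K).ncard) (Set.toFinite _) ⟨J, Set.subset_union_right, hJ, hlt⟩
  have hIK : ¬ I ⊆ K := by
    intro hsub
    obtain ⟨e, heK, heI⟩ : ∃ e ∈ K, e ∉ I := by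
      by_contra h
      push Not at h
      exact absurd (Set.ncard_le_ncard (show K ⊆ I from h)) (by omega)
    have heJ : e ∈ J := (hKsub heK).resolve_left heI
    refine hcon e heJ heI fun X hX hXs => hKind X hX (hXs.trans ?_)
    exact Set.insert_subset heK hsub
  obtain ⟨e, heI, heK⟩ := Set.not_subset.1 hIK
  have circ : ∀ f ∈ K, f ∉ I → ∃ X ∈ M.circuits,
      Function.support X ⊆ insert e K \ {f} ∧ X e ≠ 0 := by
    intro f hfK hfI
    have hfe : f ≠ e := fun h => hfI (h ▸ heI)
    by_contra hno
    push Not at hno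
    have hTind : M.Independent (insert e K \ {f}) := by
      intro X hX hXs
      have hXe := hno X hX hXs
      refine hKind X hX fun g hg => ?_
      rcases (hXs hg).1 with h | h
      · exact absurd (h ▸ hXe) hg
      · exact h
    have hcard : (insert e K \ {f}).ncard = K.ncard := by
      rw [Set.ncard_sdiff_singleton_of_mem (Set.mem_insert_of_mem _ hfK),
        Set.ncard_insert_of_notMem heK]
      simp
    have hmem := hKmin (insert e K \ {f}) ⟨?_, hTind, by omega⟩
    · have hss : I \ (insert e K \ {f}) ⊂ I \ K := by
        refine ⟨fun g hg => ⟨hg.1, fun hgK => hg.2 ⟨Or.inr hgK, ?_⟩⟩, fun h => ?_⟩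
        · rintro rfl
          exact hfI hg.1
        · exact (h ⟨heI, heK⟩).2 ⟨Or.inl rfl, fun h' => hfe h'.symm⟩
      exact absurd (Set.ncard_lt_ncard hss) (by omega)
    · rintro g ⟨rfl | hg, -⟩
      · exact Or.inl heI
      · exact hKsub hg
  obtain ⟨g, hgK, hgI⟩ : ∃ g ∈ K, g ∉ I := by
    by_contra h
    push Not at h
    exact absurd (Set.ncard_le_ncard (show K ⊆ I from h)) (by omega)
  obtain ⟨X, hX, hXs, hXe⟩ := circ g hgK hgI
  obtain ⟨h, hhX, hhI⟩ := Set.not_subset.1 (hI X hX)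
  have hhK : h ∈ K := by
    rcases (hXs hhX).1 with h' | h'
    · exact absurd (h' ▸ heI) hhI
    · exact h'
  obtain ⟨Y, hY, hYs, hYe⟩ := circ h hhK hhI
  have hne : Function.support X ≠ Function.support Y := fun heq =>
    (hYs (heq ▸ hhX)).2 rfl
  obtain ⟨Z, hZ, hZs⟩ := M.exists_support_subset hX hY hne hXe hYe
  refine hKind Z hZ fun f hf => ?_
  obtain ⟨hf1, hf2⟩ := hZs hf
  rcases hf1 with hf1 | hf1
  · exact (hXs hf1).1.resolve_left hf2
  · exact (hYs hf1).1.resolve_left hf2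

/-- The underlying matroid: its circuits are the supports of the signed circuits. -/
def toMatroid [Finite E] (M : OrientedMatroid E) : Matroid E :=
  (IndepMatroid.ofFinite (E := Set.univ) Set.finite_univ M.Independent
    (fun X hX hs => M.zero_notMem (by
      have : X = 0 := by
        rw [← Function.support_eq_empty_iff]
        exact Set.subset_empty_iff.1 hs
      exact this ▸ hX))
    (fun _ _ hJ hIJ X hX hs => hJ X hX (hs.trans hIJ))
    (fun _ _ hI hJ hlt => Independent.augment M hI hJ hlt)
    (fun _ _ => Set.subset_univ _)).matroid

/-- The rank of a set in the underlying matroid. -/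
noncomputable def rk [Finite E] (M : OrientedMatroid E) (A : Set E) : ℕ :=
  (M.toMatroid.eRk A).toNat

/-- The signed cocircuits: the signed sets which are supported by a cocircuit of the underlying
matroid and are orthogonal to all signed circuits. -/
def cocircuits [Finite E] (M : OrientedMatroid E) : Set (SignedSet E) :=
  {Y | M.toMatroid.IsCocircuit (Function.support Y) ∧ ∀ X ∈ M.circuits, X.Orthogonal Y}

/-- `V` is a vector, that is, a conformal union of (possibly zero) signed circuits: each signed
element of `V` lies in a signed circuit all of whose signed elements belong to `V`. -/
def IsVector (M : OrientedMatroid E) (V : SignedSet E) : Prop :=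
  ∀ e, V e ≠ 0 → ∃ X ∈ M.circuits, X e = V e ∧ ∀ f, X f ≠ 0 → X f = V f

/-- `M → N` is an oriented matroid perspective: any circuit of `M` is a vector of `N`. -/
def IsPerspective (M N : OrientedMatroid E) : Prop :=
  ∀ X ∈ M.circuits, N.IsVector X

/-- No positive circuit. -/
def IsAcyclic (M : OrientedMatroid E) : Prop :=
  ∀ X ∈ M.circuits, ¬ X.IsPositive

/-- Every element lies in a positive circuit. -/
def IsTotallyCyclic (M : OrientedMatroid E) : Prop :=
  ∀ e, ∃ X ∈ M.circuits, X.IsPositive ∧ X e ≠ 0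

/-- The reorientation `-_A M`. -/
def reorient [DecidableEq E] (A : Finset E) (M : OrientedMatroid E) : OrientedMatroid E where
  circuits := {X | X.reorient A ∈ M.circuits}
  zero_notMem h := by
    refine M.zero_notMem ?_
    have h' : (0 : SignedSet E).reorient A ∈ M.circuits := h
    convert h' using 1
    funext e
    simp [SignedSet.reorient]
  neg_mem X hX := by
    have := M.neg_mem _ hX
    change (-X).reorient A ∈ M.circuits
    convert this using 1
    funext e
    simp only [SignedSet.reorient, Pi.neg_apply]
    split_ifs <;> rfl
  eq_or_eq_neg X hX Y hY h := by
    have hs : ∀ W : SignedSet E, Function.support (W.reorient A) = Function.support W := by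
      intro W
      ext e
      simp only [SignedSet.reorient, Function.mem_support]
      split_ifs <;> simp
    have := M.eq_or_eq_neg _ hX _ hY (by rw [hs, hs]; exact h)
    rcases this with h1 | h1
    · left
      funext e
      have := congrFun h1 e
      simp only [SignedSet.reorient] at this
      split_ifs at this
      · exact neg_injective this
      · exact this
    · right
      funext e
      have := congrFun h1 e
      simp only [SignedSet.reorient, Pi.neg_apply] at this ⊢
      split_ifs at this
      · exact neg_injective this
      · exact this
  elimination X hX Y hY hne e he heXY := by
    have hinv : ∀ W : SignedSet E, (W.reorient A).reorient A = W := by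
      intro W
      funext f
      simp only [SignedSet.reorient]
      split_ifs <;> simp
    have h1 : X.reorient A ≠ -Y.reorient A := by
      intro h
      apply hne
      funext f
      have := congrFun h f
      simp only [SignedSet.reorient, Pi.neg_apply] at this ⊢
      split_ifs at this
      · exact neg_injective this
      · exact this
    have h2 : X.reorient A e ≠ 0 := by
      simp only [SignedSet.reorient]
      split_ifs
      · simpa using he
      · exact he
    have h3 : X.reorient A e = -Y.reorient A e := by
      simp only [SignedSet.reorient]
      split_ifs
      · rw [heXY]
      · exact heXY
    obtain ⟨Z, hZ, hZe, hZf⟩ := M.elimination _ hX _ hY h1 e h2 h3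
    refine ⟨Z.reorient A, ?_, ?_, fun f hf => ?_⟩
    · change (Z.reorient A).reorient A ∈ M.circuits
      rw [hinv]
      exact hZ
    · simp [SignedSet.reorient, hZe]
    · have := hZf f
      simp only [SignedSet.reorient] at this hf ⊢
      split_ifs at this hf ⊢
      · have hf' : Z f ≠ 0 := fun h => hf (by rw [h]; rfl)
        rcases this hf' with h | h
        · left
          rw [h, neg_neg]
        · right
          rw [h, neg_neg]
      · exact this hf

/-- The Tutte polynomial `t(M,N;x,y,z)` of `M → N`, where `x`, `y`, `z` are the variables
`X 0`, `X 1`, `X 2`. For a perspective no subtraction of ranks is truncated. -/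
noncomputable def tuttePolynomial [Fintype E] (M N : OrientedMatroid E) :
    MvPolynomial (Fin 3) ℤ :=
  ∑ A : Finset E,
    (MvPolynomial.X 0 - 1) ^ (N.rk Set.univ - N.rk A) *
    (MvPolynomial.X 1 - 1) ^ (A.card - M.rk A) *
    MvPolynomial.X 2 ^ ((M.rk Set.univ - N.rk Set.univ) - (M.rk A - N.rk A))

/-- `t(M,N;x,y,1)` as a polynomial in the variables `x = X 0` and `y = X 1`. -/
noncomputable def tuttePolynomialOne [Fintype E] (M N : OrientedMatroid E) :
    MvPolynomial (Fin 2) ℤ :=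
  MvPolynomial.aeval ![MvPolynomial.X 0, MvPolynomial.X 1, 1] (tuttePolynomial M N)

/-- The coefficient of `x ^ i * y ^ j` in `t(M,N;x,y,1)`. -/
noncomputable def tutteCoeff [Fintype E] (M N : OrientedMatroid E) (i j : ℕ) : ℤ :=
  (tuttePolynomialOne M N).coeff (Finsupp.single 0 i + Finsupp.single 1 j)

/-- The value of `t(M,N;x,y,z)` at integers `x`, `y`, `z`. -/
noncomputable def tutteEval [Fintype E] (M N : OrientedMatroid E) (x y z : ℤ) : ℤ :=
  MvPolynomial.eval ![x, y, z] (tuttePolynomial M N)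

end Basic

section Activity

variable {E : Type*} [Fintype E] [LinearOrder E]

open Classical in
/-- The set `O(M)` of active elements: the smallest elements of the positive circuits. -/
noncomputable def active (M : OrientedMatroid E) : Finset E :=
  {a | ∃ X ∈ M.circuits, X.IsPositive ∧ IsLeast (Function.support X) a}

open Classical in
/-- The set `O^*(M)` of dual-active elements: the smallest elements of the positive cocircuits. -/
noncomputable def dualActive (M : OrientedMatroid E) : Finset E :=
  {a | ∃ Y ∈ M.cocircuits, Y.IsPositive ∧ IsLeast (Function.support Y) a}

open Classical in
/-- The union of the positive circuits whose smallest element is in `S`. -/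
noncomputable def circuitUnion (M : OrientedMatroid E) (S : Set E) : Finset E :=
  {e | ∃ X ∈ M.circuits, X.IsPositive ∧ (∃ a ∈ S, IsLeast (Function.support X) a) ∧ X e ≠ 0}

open Classical in
/-- The union of the positive cocircuits whose smallest element is in `S`. -/
noncomputable def cocircuitUnion (M : OrientedMatroid E) (S : Set E) : Finset E :=
  {e | ∃ Y ∈ M.cocircuits, Y.IsPositive ∧ (∃ a ∈ S, IsLeast (Function.support Y) a) ∧ Y e ≠ 0}

/-- The cyclic part, of the active partition of any `M → N`, with smallest element the active
element `a` of `M`. If `a` is the `k`-th active element `g_k`, then the two unions are the sets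
`G_{k-1}` and `G_k` of the active filtration. -/
noncomputable def cyclicPart (M : OrientedMatroid E) (a : E) : Finset E :=
  M.circuitUnion (Set.Ici a) \ M.circuitUnion (Set.Ioi a)

/-- The acyclic part, of the active partition of any `M → N`, with smallest element the
dual-active element `a` of `N`. If `a` is the `k`-th dual-active element `h_k`, then the two
unions are the complements of the sets `H_{k-1}` and `H_k` of the active filtration. -/
noncomputable def acyclicPart (N : OrientedMatroid E) (a : E) : Finset E :=
  N.cocircuitUnion (Set.Ici a) \ N.cocircuitUnion (Set.Ioi a)

/-- The activity class of the reorientation `-_A M → -_A N`: the reorientations obtained from it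
by reorienting any union of acyclic and cyclic parts of its active partition. A reorientation is
identified with the set of its reoriented elements. -/
def activityClass (M N : OrientedMatroid E) (A : Finset E) : Set (Finset E) :=
  {B | ∃ P ⊆ (N.reorient A).dualActive, ∃ Q ⊆ (M.reorient A).active,
    B = symmDiff A (P.biUnion (N.reorient A).acyclicPart ∪ Q.biUnion (M.reorient A).cyclicPart)}

/-- The set of all activity classes of reorientations of `M → N`. -/
def activityClasses (M N : OrientedMatroid E) : Set (Set (Finset E)) :=
  Set.range (activityClass M N)

/-- `-_A M` is active-fixed with respect to `M`. -/
def ActiveFixed (M : OrientedMatroid E) (A : Finset E) : Prop :=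
  (M.reorient A).active ∩ A = ∅

/-- `-_A M` is dual-active-fixed with respect to `M`. -/
def DualActiveFixed (M : OrientedMatroid E) (A : Finset E) : Prop :=
  (M.reorient A).dualActive ∩ A = ∅

/-- The number of reorientations `-_A M → -_A N` with the property `p A`. -/
noncomputable def numReorientations (p : Finset E → Prop) : ℕ :=
  {A : Finset E | p A}.ncard

/-- The number of activity classes of reorientations of `M → N` all of whose members have the
property `p`. -/
noncomputable def numClasses (M N : OrientedMatroid E) (p : Finset E → Prop) : ℕ :=
  {K ∈ activityClasses M N | ∀ A ∈ K, p A}.ncard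

end Activity

end OrientedMatroid

/-!
The proof has two independent halves: an expansion of the Tutte polynomial over all reorientations,
`t(M,N;2u,2v,1) = ∑ A, u ^ |O*(-_A N)| * v ^ |O(-_A M)|`, and a decomposition of the set of
reorientations into activity classes with `2 ^ i * 2 ^ j` members each.

Both use the signed circuits of `M` and the signed cocircuits of `N` only through three properties:
closure under negation, orthogonality, and the painting property (Farkas' lemma), collected in
`IsDualPair`. These properties are invariant under duality, so each statement on active elements gives one on
dual-active elements. That an oriented matroid has them is `OrientedMatroid.isDualPair`; its core is
`OrientedMatroid.exists_signature`, by which every hyperplane complement carries a signature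
orthogonal to all circuits. A perspective enters through the fact that the circuits of `M` are
orthogonal to the cocircuits of `N`.

For the expansion, remove the largest element `ω`. Minors are never constructed: a minor is given by
its ground set `S`, the contracted set and the deleted set, as subsets of `E`. Unless `ω` is a loop
of `M` or a coloop of `N`, the active sets for the two signs of `ω` are those of the deletion and
the contraction of `ω`, in some order, since eliminating `ω` between two positive circuits through
`ω`, one for each sign, makes the smaller of their smallest elements active in the deletion
(`activeIn_deletion_contraction`). The same holds for dual-active sets, and the orders for `M` and
`N` match, because no positive circuit of `-_A M` meets a positive cocircuit of `-_A N`
(`activitySum_insert`). The rank generating function satisfies the same recursion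
(`OrientedMatroid.tutteSum_two_mul`).

For the classes, reorienting a union of parts of the active partition preserves the two filtrations
that define the partition (`posUnion_reorientFamily_partUnion`), hence the active and dual-active
elements and the parts themselves. Each part contains its index and no other active or dual-active
element, so a class with `i` dual-active and `j` active elements is a cube of dimension `i + j`,
with exactly one fixed member. Summing over classes turns the expansion into
`t(M,N;x,y,1) = ∑ x ^ i * y ^ j` over the fixed reorientations
(`OrientedMatroid.tuttePolynomialOne_eq`), from which coefficients and evaluations are read off.
-/

/-! ### Signatures of cocircuits -/

namespace SignedSet

variable {E : Type*}

/-- The form in which orthogonality is used: two orthogonal signed sets whose products are all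
nonnegative have disjoint supports. -/
theorem Orthogonal.mul_eq_zero {X Y : SignedSet E} (h : X.Orthogonal Y)
    (hnn : ∀ e, 0 ≤ X e * Y e) (e : E) : X e * Y e = 0 := by
  rcases h with h | ⟨-, f, hf⟩
  · exact h e
  · have := hnn f
    rw [hf] at this
    exact absurd this (by decide)

theorem orthogonal_of_forall {X Y : SignedSet E}
    (h₁ : (∀ e, 0 ≤ X e * Y e) → ∀ e, X e * Y e = 0)
    (h₂ : (∀ e, 0 ≤ -X e * Y e) → ∀ e, -X e * Y e = 0) : X.Orthogonal Y := by
  by_contra hcon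
  simp only [Orthogonal, not_or, not_and_or, not_exists, not_forall] at hcon
  obtain ⟨⟨e, he⟩, h | h⟩ := hcon
  · refine he ?_
    have := h₂ (fun f => ?_) e
    · revert this
      rw [neg_mul]
      generalize X e * Y e = a
      revert a
      decide
    · have := h f
      rw [neg_mul]
      revert this
      generalize X f * Y f = a
      revert a
      decide
  · refine he (h₁ (fun f => ?_) e)
    have := h f
    revert this
    generalize X f * Y f = a
    revert a
    decide

end SignedSet

namespace OrientedMatroid

variable {E : Type*}

section Signature

variable (M : OrientedMatroid E)

theorem toMatroid_indep_iff [Finite E] {I : Set E} : M.toMatroid.Indep I ↔ M.Independent I :=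
  Iff.rfl

theorem toMatroid_ground [Finite E] : M.toMatroid.E = Set.univ := rfl

variable {M}

theorem Independent.subset {I J : Set E} (hJ : M.Independent J) (h : I ⊆ J) : M.Independent I :=
  fun X hX hs => hJ X hX (hs.trans h)

/-- Two circuits inside `B ∪ {e, d}`, where `B ∪ {e}` is independent, agree up to a global sign
on `{e, d}`. -/
theorem apply_eq_of_support_subset {B : Set E} {e d : E} (hB : M.Independent (insert e B))
    {X Y : SignedSet E} (hX : X ∈ M.circuits) (hY : Y ∈ M.circuits)
    (hXs : Function.support X ⊆ insert d (insert e B))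
    (hYs : Function.support Y ⊆ insert d (insert e B))
    (he : X e = Y e) (he0 : X e ≠ 0) (hXd : X d ≠ 0) (hYd : Y d ≠ 0) : X d = Y d := by
  by_contra hne
  have hd : X d = -Y d := by
    revert hne hXd hYd
    generalize X d = a
    generalize Y d = b
    revert a b
    decide
  have hXY : X ≠ -Y := by
    rintro rfl
    revert he he0
    simp only [Pi.neg_apply]
    generalize Y e = b
    revert b
    decide
  obtain ⟨Z, hZ, hZd, hZf⟩ := M.elimination X hX Y hY hXY d hXd hd
  refine hB Z hZ fun f hf => ?_
  have hfd : f ≠ d := by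
    rintro rfl
    exact hf hZd
  have : f ∈ insert d (insert e B) := by
    rcases hZf f hf with h | h
    · exact hXs (by rw [Function.mem_support, ← h]; exact hf)
    · exact hYs (by rw [Function.mem_support, ← h]; exact hf)
  exact this.resolve_left hfd

theorem apply_ne_zero_of_support_subset {B : Set E} {e d : E} (hB : M.Independent (insert e B))
    {X : SignedSet E} (hX : X ∈ M.circuits) (hXs : Function.support X ⊆ insert d (insert e B)) :
    X d ≠ 0 := by
  intro h
  refine hB X hX fun f hf => (hXs hf).resolve_left ?_
  rintro rfl
  exact hf h

/-- Two circuits that meet the complement of a hyperplane `H` in the same two elements agree up to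
a global sign on these elements. For two bases `B` and `B'` of `H` containing the rest of the
two circuits, the proof moves the first circuit towards `B'` by basis exchanges. -/
theorem apply_eq_of_isBasis [Finite E] {H : Set E} {e d : E}
    (hind : ∀ B, M.toMatroid.IsBasis B H → M.Independent (insert e B))
    (hind' : ∀ B, M.toMatroid.IsBasis B H → M.Independent (insert d B))
    (heH : e ∉ H) (hdH : d ∉ H)
    (n : ℕ) : ∀ (B B' : Set E), M.toMatroid.IsBasis B H → M.toMatroid.IsBasis B' H →
    (B \ B').ncard = n → ∀ X ∈ M.circuits, ∀ Y ∈ M.circuits,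
    Function.support X ⊆ insert d (insert e B) → Function.support Y ⊆ insert d (insert e B') →
    X e = Y e → X e ≠ 0 → X d ≠ 0 → Y d ≠ 0 → X d = Y d := by
  induction n with
  | zero =>
    intro B B' hB hB' hn X hX Y hY hXs hYs he he0 hXd hYd
    rw [Set.ncard_eq_zero (Set.toFinite _), Set.sdiff_eq_empty] at hn
    have hBB : B = B' := hB.eq_of_subset_indep hB'.indep hn hB'.subset
    subst hBB
    exact apply_eq_of_support_subset (hind B hB) hX hY hXs hYs he he0 hXd hYd
  | succ n ih =>
    intro B B' hB hB' hn X hX Y hY hXs hYs he he0 hXd hYd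
    obtain ⟨b, hb⟩ : (B \ B').Nonempty := by
      rw [← Set.ncard_pos (Set.toFinite _)]
      omega
    obtain ⟨c, hc, hB₂⟩ := hB.exchange hB' hb
    have hbe : b ≠ e := fun h => heH (h ▸ hB.subset hb.1)
    have hbd : b ≠ d := fun h => hdH (h ▸ hB.subset hb.1)
    have hce : c ≠ e := fun h => heH (h ▸ hB'.subset hc.1)
    have hcd : c ≠ d := fun h => hdH (h ▸ hB'.subset hc.1)
    set B₂ := insert c (B \ {b}) with hB₂def
    have hcard : (B₂ \ B').ncard = n := by
      have : B₂ \ B' = (B \ B') \ {b} := by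
        ext f
        simp only [hB₂def, Set.mem_sdiff, Set.mem_insert_iff, Set.mem_singleton_iff]
        constructor
        · rintro ⟨rfl | h, h2⟩
          · exact absurd hc.1 h2
          · exact ⟨⟨h.1, h2⟩, h.2⟩
        · rintro ⟨⟨h1, h2⟩, h3⟩
          exact ⟨Or.inr ⟨h1, h3⟩, h2⟩
      rw [this, Set.ncard_sdiff_singleton_of_mem hb, hn]
      rfl
    -- It is enough to move `X` into `B₂ ∪ {e, d}` without changing its signs on `e` and `d`.
    suffices h : ∃ Z ∈ M.circuits, Function.support Z ⊆ insert d (insert e B₂) ∧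
        Z e = X e ∧ Z d = X d by
      obtain ⟨Z, hZ, hZs, hZe, hZd⟩ := h
      rw [← hZd]
      exact ih B₂ B' hB₂ hB' hcard Z hZ Y hY hZs hYs (hZe.trans he) (hZe ▸ he0) (hZd ▸ hXd) hYd
    by_cases hXb : X b = 0
    · refine ⟨X, hX, fun f hf => ?_, rfl, rfl⟩
      have hfb : f ≠ b := by
        rintro rfl
        exact hf hXb
      rcases hXs hf with h | h | h
      · exact Or.inl h
      · exact Or.inr (Or.inl h)
      · exact Or.inr (Or.inr (Or.inr ⟨h, hfb⟩))
    -- The circuit of `B ∪ {c}` contains `b`.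
    obtain ⟨W, hW, hWs⟩ : ∃ W ∈ M.circuits, Function.support W ⊆ insert c B := by
      by_contra hcon
      push Not at hcon
      have hi : M.Independent (insert c B) := hcon
      have := hB.eq_of_subset_indep ((M.toMatroid_indep_iff).2 hi) (Set.subset_insert _ _)
        (Set.insert_subset (hB'.subset hc.1) hB.subset)
      exact hc.2 (this ▸ Set.mem_insert _ _)
    have hWb : W b ≠ 0 := by
      intro h
      refine (M.toMatroid_indep_iff).1 hB₂.indep W hW fun f hf => ?_
      have hfb : f ≠ b := by
        rintro rfl
        exact hf h
      rcases hWs hf with h | h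
      · exact Or.inl h
      · exact Or.inr ⟨h, hfb⟩
    have hWe : W e = 0 := by
      by_contra h
      rcases hWs h with h | h
      · exact hce h.symm
      · exact heH (hB.subset h)
    have hWd : W d = 0 := by
      by_contra h
      rcases hWs h with h | h
      · exact hcd h.symm
      · exact hdH (hB.subset h)
    obtain ⟨V, hV, hVb, hVs, hVe, hVd⟩ : ∃ V ∈ M.circuits, X b = -V b ∧
        Function.support V ⊆ insert c B ∧ V e = 0 ∧ V d = 0 := by
      by_cases h : X b = -W b
      · exact ⟨W, hW, h, hWs, hWe, hWd⟩
      · refine ⟨-W, M.neg_mem W hW, ?_, ?_, by simp [hWe], by simp [hWd]⟩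
        · revert h hXb hWb
          simp only [Pi.neg_apply]
          generalize X b = x
          generalize W b = w
          revert x w
          decide
        · intro f hf
          exact hWs (by simpa using hf)
    have hXV : X ≠ -V := by
      rintro rfl
      simp [hVe] at he0
    obtain ⟨Z, hZ, hZb, hZf⟩ := M.elimination X hX V hV hXV b hXb hVb
    have hZs : Function.support Z ⊆ insert d (insert e B₂) := by
      intro f hf
      have hfb : f ≠ b := by
        rintro rfl
        exact hf hZb
      rcases hZf f hf with h | h
      · rcases hXs (by rw [Function.mem_support, ← h]; exact hf) with h | h | h
        · exact Or.inl h
        · exact Or.inr (Or.inl h)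
        · exact Or.inr (Or.inr (Or.inr ⟨h, hfb⟩))
      · rcases hVs (by rw [Function.mem_support, ← h]; exact hf) with h | h
        · exact Or.inr (Or.inr (Or.inl h))
        · exact Or.inr (Or.inr (Or.inr ⟨h, hfb⟩))
    have hZd : Z d ≠ 0 := apply_ne_zero_of_support_subset (hind B₂ hB₂) hZ hZs
    have hZe : Z e ≠ 0 := apply_ne_zero_of_support_subset (hind' B₂ hB₂) hZ
      (by rwa [Set.insert_comm])
    refine ⟨Z, hZ, hZs, ?_, ?_⟩
    · exact (hZf e hZe).resolve_right (fun h => hZe (h.trans hVe))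
    · exact (hZf d hZd).resolve_right (fun h => hZd (h.trans hVd))

/-- A circuit that meets `H`, the zero set of `Y`, inside a basis `B` of `H` cannot agree with `Y`
on the nonempty set where both are nonzero: eliminate its elements outside `B ∪ {e}` one by one
with the circuits of `B ∪ {e, d}`. -/
theorem not_conformal_of_support_subset [Finite E] {B : Set E} {e : E} {Y : SignedSet E}
    (hBe : M.Independent (insert e B)) (hYB : ∀ f ∈ B, Y f = 0) (hYe : Y e = 1)
    (hfund : ∀ d, d ≠ e → Y d ≠ 0 → ∃ X ∈ M.circuits, Function.support X ⊆ insert d (insert e B) ∧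
      X d ≠ 0 ∧ X e * X d = -Y d)
    (n : ℕ) : ∀ X ∈ M.circuits, (∀ f, X f ≠ 0 → Y f = 0 → f ∈ B) →
      (∀ f, 0 ≤ X f * Y f) → {f | f ≠ e ∧ X f ≠ 0 ∧ Y f ≠ 0}.ncard ≤ n → False := by
  induction n with
  | zero =>
    intro X hX hXB hXY hn
    have hn' : {f | f ≠ e ∧ X f ≠ 0 ∧ Y f ≠ 0} = ∅ := by
      rw [← Set.ncard_eq_zero (Set.toFinite _)]
      omega
    refine hBe X hX fun f hf => ?_
    by_cases hfe : f = e
    · exact Or.inl hfe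
    · refine Or.inr (hXB f hf ?_)
      by_contra hY
      exact (Set.eq_empty_iff_forall_notMem.1 hn' f) ⟨hfe, hf, hY⟩
  | succ n ih =>
    intro X hX hXB hXY hn
    by_cases hemp : {f | f ≠ e ∧ X f ≠ 0 ∧ Y f ≠ 0} = ∅
    · exact ih X hX hXB hXY (by simp [hemp])
    obtain ⟨d, hde, hXd, hYd⟩ := Set.nonempty_iff_ne_empty.2 hemp
    obtain ⟨W, hW, hWs, hWd, hWed⟩ := hfund d hde hYd
    obtain ⟨V, hV, hVd, hVs, hVe⟩ : ∃ V ∈ M.circuits, X d = -V d ∧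
        Function.support V ⊆ insert d (insert e B) ∧ V e = 1 := by
      have hXYd := hXY d
      by_cases h : X d = -W d
      · refine ⟨W, hW, h, hWs, ?_⟩
        have h' : W d = -X d := by rw [h, neg_neg]
        rw [h'] at hWed
        clear h h' hWd
        revert hXYd hXd hYd hWed
        generalize X d = x
        generalize Y d = y
        generalize W e = w
        revert x y w
        decide
      · have h' : W d = X d := by
          revert h hXd hWd
          generalize X d = x
          generalize W d = w
          revert x w
          decide
        refine ⟨-W, M.neg_mem W hW, by rw [Pi.neg_apply, h', neg_neg],
          fun f hf => hWs (by simpa using hf), ?_⟩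
        rw [Pi.neg_apply]
        rw [h'] at hWed
        clear h h' hWd
        revert hXYd hXd hYd hWed
        generalize X d = x
        generalize Y d = y
        generalize W e = w
        revert x y w
        decide
    have hXV : X ≠ -V := by
      rintro rfl
      have := hXY e
      rw [Pi.neg_apply, hVe, hYe] at this
      exact absurd this (by decide)
    obtain ⟨Z, hZ, hZd, hZf⟩ := M.elimination X hX V hV hXV d hXd hVd
    have hcase : ∀ f, Z f ≠ 0 → Z f = X f ∨ f = e ∧ Z f = 1 ∨ f ∈ B := by
      intro f hf
      rcases hZf f hf with h | h
      · exact Or.inl h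
      · rcases hVs (by rw [Function.mem_support, ← h]; exact hf) with h' | h' | h'
        · rw [h'] at hf
          exact absurd hZd hf
        · refine Or.inr (Or.inl ⟨h', ?_⟩)
          rw [h, h', hVe]
        · exact Or.inr (Or.inr h')
    refine ih Z hZ ?_ ?_ ?_
    · intro f hf hY
      rcases hcase f hf with h | ⟨rfl, -⟩ | h
      · exact hXB f (h ▸ hf) hY
      · rw [hYe] at hY
        exact absurd hY (by decide)
      · exact h
    · intro f
      by_cases hf : Z f = 0
      · simp [hf]
      rcases hcase f hf with h | ⟨rfl, h⟩ | h
      · rw [h]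
        exact hXY f
      · rw [h, hYe]
        decide
      · simp [hYB f h]
    · have hss : {f | f ≠ e ∧ Z f ≠ 0 ∧ Y f ≠ 0} ⊂ {f | f ≠ e ∧ X f ≠ 0 ∧ Y f ≠ 0} := by
        refine ⟨?_, fun h => (h ⟨hde, hXd, hYd⟩ : d ≠ e ∧ Z d ≠ 0 ∧ Y d ≠ 0).2.1 hZd⟩
        rintro f ⟨hfe, hf, hY⟩
        rcases hcase f hf with h | ⟨rfl, -⟩ | h
        · exact ⟨hfe, h ▸ hf, hY⟩
        · exact absurd rfl hfe
        · exact absurd (hYB f h) hY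
      have := Set.ncard_lt_ncard hss (Set.toFinite _)
      omega

end Signature

end OrientedMatroid

namespace OrientedMatroid

variable {E : Type*}

section Signature

variable (M : OrientedMatroid E)

theorem exists_isBasis_of_mem_circuits [Finite E] {H : Set E} {X : SignedSet E}
    (hX : X ∈ M.circuits) (hXH : ¬ Function.support X ⊆ H) :
    ∃ B, M.toMatroid.IsBasis B H ∧ ∀ f ∈ H, X f ≠ 0 → f ∈ B := by
  have hI : M.Independent (Function.support X ∩ H) := by
    intro Z hZ hs
    have hZX := M.eq_or_eq_neg Z hZ X hX (hs.trans Set.inter_subset_left)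
    refine hXH fun f hf => (hs ?_).2
    rcases hZX with rfl | rfl
    · exact hf
    · simpa using hf
  obtain ⟨B, hB, hIB⟩ := Matroid.Indep.subset_isBasis_of_subset
    (M.toMatroid_indep_iff.2 hI) Set.inter_subset_right (Set.subset_univ H)
  exact ⟨B, hB, fun f hfH hf => hIB ⟨hf, hfH⟩⟩

/-- The complement of a hyperplane `H` supports a signed set orthogonal to all circuits. Here the
hyperplane is described by the two ways in which its bases extend. -/
theorem exists_signature [Finite E] {H : Set E} {e : E} (heH : e ∉ H)
    (hind : ∀ B, M.toMatroid.IsBasis B H → ∀ d ∉ H, M.Independent (insert d B))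
    (hdep : ∀ B, M.toMatroid.IsBasis B H → ∀ d ∉ H, d ≠ e →
      ¬ M.Independent (insert d (insert e B))) :
    ∃ Y : SignedSet E, Function.support Y = Hᶜ ∧ Y e = 1 ∧ ∀ X ∈ M.circuits, X.Orthogonal Y := by
  have hfund : ∀ B, M.toMatroid.IsBasis B H → ∀ d ∉ H, d ≠ e →
      ∃ X ∈ M.circuits, Function.support X ⊆ insert d (insert e B) ∧ X d ≠ 0 ∧ X e ≠ 0 := by
    intro B hB d hd hde
    have h := hdep B hB d hd hde
    simp only [Independent, not_forall, not_not] at h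
    obtain ⟨X, hX, hs⟩ := h
    exact ⟨X, hX, hs, apply_ne_zero_of_support_subset (hind B hB e heH) hX hs,
      apply_ne_zero_of_support_subset (hind B hB d hd) hX (by rwa [Set.insert_comm])⟩
  obtain ⟨B₀, hB₀⟩ := M.toMatroid.exists_isBasis H (Set.subset_univ H)
  -- The sign on `d` is forced by the circuits meeting `Hᶜ` in `{e, d}`.
  have hsign : ∀ d, ∃ s : SignType, (d ∈ H ↔ s = 0) ∧ (d = e → s = 1) ∧ (d ≠ e → d ∉ H →
      ∀ X ∈ M.circuits, Function.support X ⊆ insert d (insert e H) → X d ≠ 0 → X e ≠ 0 →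
        X e * X d = -s) := by
    intro d
    by_cases hde : d = e
    · subst hde
      exact ⟨1, by simpa using heH, fun _ => rfl, fun h => absurd rfl h⟩
    by_cases hd : d ∈ H
    · exact ⟨0, by simpa using hd, fun h => absurd h hde, fun _ h => absurd hd h⟩
    obtain ⟨X₀, hX₀, hs₀, hd₀, he₀⟩ := hfund B₀ hB₀ d hd hde
    refine ⟨-(X₀ e * X₀ d), ?_, fun h => absurd h hde, fun _ _ X hX hs hXd hXe => ?_⟩
    · refine ⟨fun h => absurd h hd, fun h => ?_⟩
      exfalso
      revert h hd₀ he₀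
      generalize X₀ d = a
      generalize X₀ e = b
      revert a b
      decide
    rw [neg_neg]
    obtain ⟨B, hB, hXB⟩ := M.exists_isBasis_of_mem_circuits hX (H := H) (fun h => heH (h hXe))
    have hsB : Function.support X ⊆ insert d (insert e B) := by
      intro f hf
      rcases hs hf with h | h | h
      · exact Or.inl h
      · exact Or.inr (Or.inl h)
      · exact Or.inr (Or.inr (hXB f h hf))
    have key : ∀ Z ∈ M.circuits, Function.support Z ⊆ insert d (insert e B₀) → Z d ≠ 0 →
        X e = Z e → X d = Z d := fun Z hZ hZs hZd hZe =>
      apply_eq_of_isBasis (fun B hB => hind B hB e heH) (fun B hB => hind B hB d hd) heH hd _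
        B B₀ hB hB₀ rfl X hX Z hZ hsB hZs hZe hXe hXd hZd
    by_cases h : X e = X₀ e
    · rw [h, key X₀ hX₀ hs₀ hd₀ h]
    · have h' : X e = -X₀ e := by
        revert h hXe he₀
        generalize X e = a
        generalize X₀ e = b
        revert a b
        decide
      rw [h', key (-X₀) (M.neg_mem _ hX₀) (fun f hf => hs₀ (by simpa using hf))
        (by simpa using hd₀) h', Pi.neg_apply, neg_mul_neg]
  choose Y hYH hYe hY using hsign
  refine ⟨Y, ?_, hYe e rfl, ?_⟩
  · ext d
    rw [Function.mem_support, Set.mem_compl_iff, hYH]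
  have key : ∀ X ∈ M.circuits, (∀ f, 0 ≤ X f * Y f) → ∀ f, X f * Y f = 0 := by
    intro X hX hnn g
    by_contra hg
    have hXH : ¬ Function.support X ⊆ H := by
      intro h
      have hXg : X g ≠ 0 := fun h => hg (by rw [h, zero_mul])
      exact hg (by rw [(hYH g).1 (h hXg), mul_zero])
    obtain ⟨B, hB, hXB⟩ := M.exists_isBasis_of_mem_circuits hX hXH
    refine not_conformal_of_support_subset (hind B hB e heH)
      (fun f hf => (hYH f).1 (hB.subset hf)) (hYe e rfl) ?_ _ X hX
      (fun f hf hYf => hXB f ((hYH f).2 hYf) hf) hnn le_rfl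
    intro d hde hYd
    have hdH : d ∉ H := fun h => hYd ((hYH d).1 h)
    obtain ⟨Z, hZ, hZs, hZd, hZe⟩ := hfund B hB d hdH hde
    exact ⟨Z, hZ, hZs, hZd, hY d hde hdH Z hZ
      (hZs.trans (Set.insert_subset_insert (Set.insert_subset_insert hB.subset))) hZd hZe⟩
  intro X hX
  exact SignedSet.orthogonal_of_forall (key X hX) (key (-X) (M.neg_mem X hX))

/-- An element outside the closure of `R` lies in a signed cocircuit avoiding `R`. -/
theorem exists_mem_cocircuits [Finite E] (R : Set E) (e : E)
    (h : ∀ X ∈ M.circuits, X e ≠ 0 → ∃ f ∉ R, f ≠ e ∧ X f ≠ 0) :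
    ∃ Y ∈ M.cocircuits, Y e = 1 ∧ ∀ f ∈ R, f ≠ e → Y f = 0 := by
  obtain ⟨I, hI⟩ := M.toMatroid.exists_isBasis (R \ {e}) (Set.subset_univ _)
  have heI : M.toMatroid.Indep (insert e I) := by
    rw [toMatroid_indep_iff]
    intro X hX hs
    have hXe : X e ≠ 0 := by
      intro h0
      refine (M.toMatroid_indep_iff).1 hI.indep X hX fun f hf => (hs hf).resolve_left ?_
      rintro rfl
      exact hf h0
    obtain ⟨f, hfR, hfe, hf⟩ := h X hX hXe
    exact hfR (hI.subset ((hs hf).resolve_left hfe)).1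
  obtain ⟨B', hB', hIB⟩ := heI.exists_isBase_superset
  have heB : e ∈ B' := hIB (Set.mem_insert _ _)
  set H := M.toMatroid.closure (B' \ {e}) with hH
  have heH : e ∉ H := hB'.indep.notMem_closure_sdiff_of_mem heB
  have hcl : ∀ B, M.toMatroid.IsBasis B H → M.toMatroid.closure B = H := by
    intro B hB
    rw [hB.closure_eq_closure, hH, Matroid.closure_closure]
  have hind : ∀ B, M.toMatroid.IsBasis B H → ∀ d ∉ H, M.Independent (insert d B) := by
    intro B hB d hd
    rw [← hcl B hB] at hd
    exact (M.toMatroid_indep_iff).1 ((hB.indep.notMem_closure_iff (Set.mem_univ d)).1 hd).1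
  obtain ⟨Y, hYs, hYe, hY⟩ := M.exists_signature heH hind (by
    intro B hB d hd hde hdep
    have hbase : M.toMatroid.IsBase (insert e B) := by
      refine ((M.toMatroid_indep_iff).2 (hind B hB e heH)).isBase_of_ground_subset_closure ?_
      rw [← Matroid.closure_insert_closure_eq_closure_insert, hcl B hB, hH,
        Matroid.closure_insert_closure_eq_closure_insert, Set.insert_sdiff_singleton,
        Set.insert_eq_of_mem heB, hB'.closure_eq]
    have := hbase.eq_of_subset_indep ((M.toMatroid_indep_iff).2 hdep) (Set.subset_insert _ _)
    rcases (this ▸ Set.mem_insert d (insert e B) : d ∈ insert e B) with h | h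
    · exact hde h
    · exact hd (hB.subset h))
  refine ⟨Y, ⟨?_, hY⟩, hYe, fun f hf hfe => ?_⟩
  · have := hB'.compl_closure_sdiff_singleton_isCocircuit heB
    rwa [toMatroid_ground, ← hH, ← Set.compl_eq_univ_sdiff, ← hYs] at this
  · have hfH : f ∈ H := by
      refine M.toMatroid.closure_subset_closure ?_ (hI.subset_closure ⟨hf, hfe⟩)
      intro g hg
      exact ⟨hIB (Or.inr hg), fun h => (hI.subset hg).2 h⟩
    by_contra hYf
    have : f ∈ Function.support Y := hYf
    rw [hYs] at this
    exact this hfH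

end Signature

end OrientedMatroid

/-! ### Dual pairs and the painting property -/

/-- Two families of signed sets form a dual pair if they are closed under negation, orthogonal to
each other, and satisfy the painting property: let `σ` prescribe the signs outside its zero set, and
let `R` split this zero set into two parts. Each `e` with `σ e ≠ 0` lies in a member of the first
family that conforms to `σ` and vanishes on the part outside `R`, or in a member of the second
family that conforms to `σ` and vanishes on the part in `R`. The signed circuits and the signed
cocircuits of an oriented matroid are the model; unlike the axioms of oriented matroids, this
notion is visibly self-dual. -/
structure IsDualPair {E : Type*} (K L : Set (SignedSet E)) : Prop where
  neg_left : ∀ X ∈ K, -X ∈ K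
  neg_right : ∀ Y ∈ L, -Y ∈ L
  orth : ∀ X ∈ K, ∀ Y ∈ L, (∀ e, 0 ≤ X e * Y e) → ∀ e, X e * Y e = 0
  painting : ∀ (σ : E → SignType) (R : Set E) (e : E), σ e ≠ 0 →
    (∃ X ∈ K, X e = σ e ∧ (∀ f, 0 ≤ σ f * X f) ∧ ∀ f ∉ R, σ f = 0 → X f = 0) ∨
    (∃ Y ∈ L, Y e = σ e ∧ (∀ f, 0 ≤ σ f * Y f) ∧ ∀ f ∈ R, σ f = 0 → Y f = 0)

theorem IsDualPair.symm {E : Type*} {K L : Set (SignedSet E)} (h : IsDualPair K L) :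
    IsDualPair L K where
  neg_left := h.neg_right
  neg_right := h.neg_left
  orth X hX Y hY hnn e := by
    rw [mul_comm]
    exact h.orth Y hY X hX (fun f => by rw [mul_comm]; exact hnn f) e
  painting σ R e he := by
    rcases h.painting σ Rᶜ e he with ⟨X, hX, h₁, h₂, h₃⟩ | ⟨Y, hY, h₁, h₂, h₃⟩
    · exact Or.inr ⟨X, hX, h₁, h₂, fun f hf => h₃ f (fun h => h hf)⟩
    · exact Or.inl ⟨Y, hY, h₁, h₂, fun f hf => h₃ f hf⟩

namespace OrientedMatroid

variable {E : Type*}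

theorem neg_mem_cocircuits [Finite E] (M : OrientedMatroid E) {Y : SignedSet E}
    (hY : Y ∈ M.cocircuits) : -Y ∈ M.cocircuits := by
  refine ⟨?_, fun X hX => ?_⟩
  · have : Function.support (-Y) = Function.support Y := by
      ext
      simp
    rw [this]
    exact hY.1
  · have := hY.2 _ (M.neg_mem X hX)
    simpa [SignedSet.Orthogonal] using this

/-- The painting property of an oriented matroid, by recolouring the signed elements other than `e`
one by one: if neither colour of `f` gives a solution for which `f` has the right sign, the two
solutions violate orthogonality. -/
theorem painting [Finite E] (M : OrientedMatroid E) (n : ℕ) :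
    ∀ (σ : E → SignType) (R : Set E) (e : E), σ e ≠ 0 → {f | f ≠ e ∧ σ f ≠ 0}.ncard = n →
    (∃ X ∈ M.circuits, X e = σ e ∧ (∀ f, 0 ≤ σ f * X f) ∧ ∀ f ∉ R, σ f = 0 → X f = 0) ∨
    (∃ Y ∈ M.cocircuits, Y e = σ e ∧ (∀ f, 0 ≤ σ f * Y f) ∧ ∀ f ∈ R, σ f = 0 → Y f = 0) := by
  classical
  have hscale : ∀ a b : SignType, a ≠ 0 → b ≠ 0 → a = b ∨ -a = b := by decide
  have hsq : ∀ a : SignType, 0 ≤ a * a := by decide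
  induction n with
  | zero =>
    intro σ R e he hn
    have hσ : ∀ f, f ≠ e → σ f = 0 := by
      rw [Set.ncard_eq_zero (Set.toFinite _)] at hn
      intro f hf
      by_contra h
      exact (Set.eq_empty_iff_forall_notMem.1 hn f) ⟨hf, h⟩
    have hconf : ∀ X : SignedSet E, X e = σ e → ∀ f, 0 ≤ σ f * X f := by
      intro X hX f
      by_cases hf : f = e
      · rw [hf, hX]
        exact hsq _
      · simp [hσ f hf]
    by_cases h : ∀ X ∈ M.circuits, X e ≠ 0 → ∃ f ∉ R, f ≠ e ∧ X f ≠ 0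
    · right
      obtain ⟨Y, hY, hYe, hYR⟩ := M.exists_mem_cocircuits R e h
      have hYR' : ∀ f ∈ R, σ f = 0 → Y f = 0 := fun f hf h0 => by
        refine hYR f hf ?_
        rintro rfl
        exact he h0
      rcases hscale (Y e) (σ e) (by rw [hYe]; decide) he with h | h
      · exact ⟨Y, hY, h, hconf Y h, hYR'⟩
      · exact ⟨-Y, M.neg_mem_cocircuits hY, h, hconf (-Y) h, fun f hf h0 => by
          simp [hYR' f hf h0]⟩
    · left
      push Not at h
      obtain ⟨X, hX, hXe, hXR⟩ := h
      have hXR' : ∀ f ∉ R, σ f = 0 → X f = 0 := fun f hf h0 => by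
        refine hXR f hf ?_
        rintro rfl
        exact he h0
      rcases hscale (X e) (σ e) hXe he with h | h
      · exact ⟨X, hX, h, hconf X h, hXR'⟩
      · exact ⟨-X, M.neg_mem X hX, h, hconf (-X) h, fun f hf h0 => by
          simp [hXR' f hf h0]⟩
  | succ n ih =>
    intro σ R e he hn
    obtain ⟨f, hfe, hf⟩ : {f | f ≠ e ∧ σ f ≠ 0}.Nonempty := by
      rw [← Set.ncard_pos (Set.toFinite _)]
      omega
    set τ := Function.update σ f 0 with hτ
    have hτf : τ f = 0 := by simp [hτ]
    have hτg : ∀ g, g ≠ f → τ g = σ g := fun g hg => by simp [hτ, hg]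
    have hcard : {g | g ≠ e ∧ τ g ≠ 0}.ncard = n := by
      have : {g | g ≠ e ∧ τ g ≠ 0} = {g | g ≠ e ∧ σ g ≠ 0} \ {f} := by
        ext g
        by_cases hg : g = f
        · simp [hg, hτf]
        · simp [hg, hτg g hg]
      rw [this, Set.ncard_sdiff_singleton_of_mem (show f ∈ {g | g ≠ e ∧ σ g ≠ 0} from ⟨hfe, hf⟩),
        hn]
      rfl
    have hτe : τ e = σ e := hτg e (Ne.symm hfe)
    have hgood : ∀ Z : SignedSet E, (∀ g, 0 ≤ τ g * Z g) → 0 ≤ σ f * Z f →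
        ∀ g, 0 ≤ σ g * Z g := by
      intro Z hZ hZf g
      by_cases hg : g = f
      · rw [hg]
        exact hZf
      · rw [← hτg g hg]
        exact hZ g
    have hne : ∀ g, g ≠ f → σ g = 0 → τ g = 0 := fun g hg h0 => (hτg g hg).trans h0
    have hneσ : ∀ g, σ g = 0 → g ≠ f := by
      rintro g h0 rfl
      exact hf h0
    rcases ih τ (R \ {f}) e (hτe ▸ he) hcard with ⟨X, hX, hXe, hXσ, hXR⟩ | ⟨Y, hY, hYe, hYσ, hYR⟩
    · left
      refine ⟨X, hX, hXe.trans hτe, hgood X hXσ ?_, fun g hg h0 => ?_⟩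
      · simp [hXR f (by simp) hτf]
      · exact hXR g (fun h => hg h.1) (hne g (hneσ g h0) h0)
    by_cases hYf : 0 ≤ σ f * Y f
    · right
      exact ⟨Y, hY, hYe.trans hτe, hgood Y hYσ hYf, fun g hg h0 =>
        hYR g ⟨hg, hneσ g h0⟩ (hne g (hneσ g h0) h0)⟩
    rcases ih τ (insert f R) e (hτe ▸ he) hcard with ⟨X, hX, hXe, hXσ, hXR⟩ | ⟨Z, hZ, hZe, hZσ, hZR⟩
    · by_cases hXf : 0 ≤ σ f * X f
      · left
        exact ⟨X, hX, hXe.trans hτe, hgood X hXσ hXf, fun g hg h0 =>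
          hXR g (fun h => hg (h.resolve_left (hneσ g h0))) (hne g (hneσ g h0) h0)⟩
      · exfalso
        have := (hY.2 X hX).mul_eq_zero (fun g => ?_) e
        · rw [hXe, hYe, hτe] at this
          revert this he
          generalize σ e = a
          revert a
          decide
        · by_cases hg : g = f
          · rw [hg]
            revert hXf hYf
            generalize σ f = a
            generalize X f = x
            generalize Y f = y
            revert a x y
            decide
          by_cases h0 : τ g = 0
          · by_cases hgR : g ∈ R
            · simp [hYR g ⟨hgR, hg⟩ h0]
            · simp [hXR g (fun h => hgR (h.resolve_left hg)) h0]
          · have h1 := hXσ g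
            have h2 := hYσ g
            revert h0 h1 h2
            generalize τ g = a
            generalize X g = x
            generalize Y g = y
            revert a x y
            decide
    · right
      refine ⟨Z, hZ, hZe.trans hτe, hgood Z hZσ ?_, fun g hg h0 => ?_⟩
      · simp [hZR f (Set.mem_insert _ _) hτf]
      · exact hZR g (Or.inr hg) (hne g (hneσ g h0) h0)

theorem isDualPair [Finite E] (M : OrientedMatroid E) : IsDualPair M.circuits M.cocircuits where
  neg_left := M.neg_mem
  neg_right _ := M.neg_mem_cocircuits
  orth X hX _ hY := (hY.2 X hX).mul_eq_zero
  painting σ R e he := M.painting _ σ R e he rfl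

end OrientedMatroid

theorem SignType.nonneg_or_neg_nonneg (a : SignType) : 0 ≤ a ∨ 0 ≤ -a := by
  revert a
  decide

theorem SignType.eq_one_of_nonneg {a : SignType} (h : 0 ≤ a) (h0 : a ≠ 0) : a = 1 := by
  revert a
  decide

theorem SignType.mul_nonneg' {a b : SignType} (ha : 0 ≤ a) (hb : 0 ≤ b) : 0 ≤ a * b := by
  revert a b
  decide

theorem SignType.eq_zero_of_mul_eq_zero {a b : SignType} (h : a * b = 0) (hb : b ≠ 0) : a = 0 := by
  revert a b
  decide

namespace SignedSet

variable {E : Type*} [DecidableEq E]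

theorem reorient_of_mem {A : Finset E} {e : E} (h : e ∈ A) (X : SignedSet E) :
    X.reorient A e = -X e := if_pos h

theorem reorient_of_notMem {A : Finset E} {e : E} (h : e ∉ A) (X : SignedSet E) :
    X.reorient A e = X e := if_neg h

theorem reorient_eq_zero_iff {A : Finset E} {e : E} {X : SignedSet E} :
    X.reorient A e = 0 ↔ X e = 0 := by
  unfold reorient
  split_ifs
  · generalize X e = a
    revert a
    decide
  · rfl

theorem reorient_mul_reorient (A : Finset E) (X Y : SignedSet E) (e : E) :
    X.reorient A e * Y.reorient A e = X e * Y e := by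
  unfold reorient
  split_ifs
  · exact neg_mul_neg _ _
  · rfl

theorem reorient_neg (A : Finset E) (X : SignedSet E) : (-X).reorient A = -X.reorient A := by
  funext e
  unfold reorient
  simp only [Pi.neg_apply]
  split_ifs <;> rfl

theorem reorient_reorient (A B : Finset E) (X : SignedSet E) :
    (X.reorient A).reorient B = X.reorient (symmDiff A B) := by
  funext e
  by_cases hA : e ∈ A <;> by_cases hB : e ∈ B <;> simp [reorient, Finset.mem_symmDiff, hA, hB]

theorem reorient_reorient_self (A : Finset E) (X : SignedSet E) :
    (X.reorient A).reorient A = X := by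
  rw [reorient_reorient, symmDiff_self]
  funext e
  simp [reorient]

end SignedSet

/-! ### Elimination -/

section Elimination

variable {E : Type*} {K L : Set (SignedSet E)}

/-- Strong elimination: besides eliminating `e`, an element `f` on which `X` and `X'` do not
conflict can be kept. -/
theorem IsDualPair.elimination (h : IsDualPair K L) {X X' : SignedSet E} (hX : X ∈ K) (hX' : X' ∈ K)
    {e f : E} (hee : X' e = -X e) (hf : X f ≠ 0) (hff : X' f ≠ -X f) :
    ∃ Z ∈ K, Z e = 0 ∧ Z f = X f ∧ ∀ g, Z g = 0 ∨ Z g = X g ∨ Z g = X' g := by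
  classical
  set σ : E → SignType := fun g => if X' g = -X g then 0 else if X g = 0 then X' g else X g with hσ
  have hσf : σ f = X f := by simp [hσ, hff, hf]
  have hσe : σ e = 0 := by simp [hσ, hee]
  rcases h.painting σ {g | g ≠ e ∧ X g ≠ 0} f (hσf ▸ hf) with
    ⟨Z, hZ, hZf, hZσ, hZR⟩ | ⟨Y, hY, hYf, hYσ, hYR⟩
  · refine ⟨Z, hZ, hZR e (by simp) hσe, hZf.trans hσf, fun g => ?_⟩
    have h1 := hZσ g
    have h2 := hZR g
    have h3 : σ g = if X' g = -X g then 0 else if X g = 0 then X' g else X g := rfl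
    by_cases hXg : X g = 0
    · by_cases hσg : σ g = 0
      · exact Or.inl (h2 (by simp [hXg]) hσg)
      · have h4 : σ g = X' g := by
          rw [h3] at hσg ⊢
          split_ifs at hσg ⊢
          · exact absurd rfl hσg
          · rfl
        rw [h4] at h1 hσg
        revert h1 hσg
        generalize X' g = a
        generalize Z g = b
        generalize X g = c
        revert a b c
        decide
    · rw [h3, if_neg hXg] at h1
      revert hXg h1
      generalize X' g = a
      generalize Z g = b
      generalize X g = c
      revert a b c
      decide
  · exfalso
    -- Away from `e`, both `X` and `X'` conform to `Y`.
    have hnn : ∀ g, g ≠ e → 0 ≤ X g * Y g ∧ 0 ≤ X' g * Y g := by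
      intro g hg
      have h1 := hYσ g
      have h2 := hYR g
      have h3 : σ g = if X' g = -X g then 0 else if X g = 0 then X' g else X g := rfl
      by_cases hXg : X g = 0
      · rw [h3, if_pos hXg] at h1
        rw [hXg] at h1 ⊢
        revert h1
        generalize X' g = a
        generalize Y g = b
        revert a b
        decide
      · by_cases hσg : σ g = 0
        · simp [h2 ⟨hg, hXg⟩ hσg]
        · rw [h3, if_neg hXg] at h1 hσg
          revert h1 hσg hXg
          generalize X' g = a
          generalize Y g = b
          generalize X g = c
          revert a b c
          decide
    by_cases hXY : 0 ≤ X e * Y e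
    · have := h.orth X hX Y hY (fun g => ?_) f
      · rw [hYf, hσf] at this
        exact hf (SignType.eq_zero_of_mul_eq_zero this hf)
      · by_cases hg : g = e
        · rw [hg]
          exact hXY
        · exact (hnn g hg).1
    · have hX'Y : X' e * Y e = 1 := by
        rw [hee]
        revert hXY
        generalize X e = a
        generalize Y e = b
        revert a b
        decide
      have := h.orth X' hX' Y hY (fun g => ?_) e
      · rw [hX'Y] at this
        exact absurd this (by decide)
      · by_cases hg : g = e
        · rw [hg, hX'Y]
          decide
        · exact (hnn g hg).2

end Elimination

/-! ### Active elements under deletion and contraction -/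

section ActiveIn

variable {E : Type*} [LinearOrder E]

/-- `X`, reoriented along `A`, shows that `a` is active in the minor with ground set `S` obtained
by contracting `F` and deleting the other elements: it is nonnegative on `S` with smallest element
`a`, arbitrary on `F`, and zero elsewhere. -/
structure Activates (S F A : Finset E) (a : E) (X : SignedSet E) : Prop where
  ne_zero : X a ≠ 0
  nonneg : ∀ e ∈ S, 0 ≤ X.reorient A e
  eq_zero_of_lt : ∀ e ∈ S, e < a → X e = 0
  eq_zero : ∀ e, e ∉ S → e ∉ F → X e = 0

open Classical in
/-- The active elements of the reorientation along `A` of the minor with ground set `S` obtained by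
contracting `F` and deleting the other elements, where `K` is the set of signed circuits. For a set
of signed cocircuits the roles of contraction and deletion are exchanged. -/
noncomputable def activeIn (K : Set (SignedSet E)) (S F A : Finset E) : Finset E :=
  {a ∈ S | ∃ X ∈ K, Activates S F A a X}

theorem mem_activeIn {K : Set (SignedSet E)} {S F A : Finset E} {a : E} :
    a ∈ activeIn K S F A ↔ a ∈ S ∧ ∃ X ∈ K, Activates S F A a X := by
  classical
  rw [activeIn, Finset.mem_filter]

/-- `ω` is a loop of the minor with ground set `insert ω S` obtained by contracting `F` and
deleting the other elements. -/
def IsLoopIn (K : Set (SignedSet E)) (S F : Finset E) (ω : E) : Prop :=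
  ∃ X ∈ K, X ω ≠ 0 ∧ (∀ e ∈ S, X e = 0) ∧ ∀ e, e ∉ insert ω S → e ∉ F → X e = 0

variable {K L : Set (SignedSet E)} {S F D A B : Finset E} {ω : E}

/-- The reorientations `A` and `B` agree on `S`. -/
def AgreeOn (S A B : Finset E) : Prop := ∀ e ∈ S, e ∈ A ↔ e ∈ B

theorem AgreeOn.refl {E : Type*} (S A : Finset E) : AgreeOn S A A := fun _ _ => Iff.rfl

theorem AgreeOn.insert (A : Finset E) (hω : ω ∉ S) : AgreeOn S A (insert ω A) := by
  intro e he
  have : e ≠ ω := by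
    rintro rfl
    exact hω he
  simp [this]

theorem AgreeOn.reorient (h : AgreeOn S A B) (X : SignedSet E) {e : E} (he : e ∈ S) :
    X.reorient A e = X.reorient B e := by
  simp only [SignedSet.reorient, h e he]

theorem Activates.insert_of_eq_zero {a : E} {X : SignedSet E} (hAB : AgreeOn S A B)
    {F' : Finset E} (hF : F' ⊆ insert ω F) (h : Activates S F' A a X) (hXω : X ω = 0)
    (hω : ∀ s ∈ S, s < ω) : Activates (insert ω S) F B a X where
  ne_zero := h.ne_zero
  nonneg e he := by
    rcases Finset.mem_insert.1 he with rfl | he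
    · exact (SignedSet.reorient_eq_zero_iff.2 hXω).ge
    · rw [← hAB.reorient X he]
      exact h.nonneg e he
  eq_zero_of_lt e he hea := by
    rcases Finset.mem_insert.1 he with rfl | he
    · exact hXω
    · exact h.eq_zero_of_lt e he hea
  eq_zero e he heF := by
    rw [Finset.mem_insert, not_or] at he
    exact h.eq_zero e he.2 fun h' => (Finset.mem_insert.1 (hF h')).elim he.1 heF

theorem Activates.of_insert {a : E} {X : SignedSet E} (hAB : AgreeOn S A B)
    (h : Activates (insert ω S) F B a X) : Activates S (insert ω F) A a X where
  ne_zero := h.ne_zero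
  nonneg e he := by
    rw [hAB.reorient X he]
    exact h.nonneg e (Finset.mem_insert_of_mem he)
  eq_zero_of_lt e he := h.eq_zero_of_lt e (Finset.mem_insert_of_mem he)
  eq_zero e he heF := by
    rw [Finset.mem_insert, not_or] at heF
    refine h.eq_zero e ?_ heF.2
    rw [Finset.mem_insert, not_or]
    exact ⟨heF.1, he⟩

theorem Activates.drop {a : E} {X : SignedSet E} (h : Activates S (insert ω F) A a X)
    (hXω : X ω = 0) : Activates S F A a X where
  ne_zero := h.ne_zero
  nonneg := h.nonneg
  eq_zero_of_lt := h.eq_zero_of_lt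
  eq_zero e he heF := by
    by_cases heω : e = ω
    · rw [heω, hXω]
    · exact h.eq_zero e he (by simp [heω, heF])

/-- If `ω` is the largest element, an element that is active in the deletion of `ω` is active
before, whatever the sign of `ω`. -/
theorem activeIn_delete_subset (hAB : AgreeOn S A B) (hωF : ω ∉ F) (hω : ∀ s ∈ S, s < ω) :
    activeIn K S F A ⊆ activeIn K (insert ω S) F B := by
  intro a ha
  obtain ⟨haS, X, hX, hXa⟩ := mem_activeIn.1 ha
  exact mem_activeIn.2 ⟨Finset.mem_insert_of_mem haS, X, hX,
    hXa.insert_of_eq_zero hAB (Finset.subset_insert _ _)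
      (hXa.eq_zero ω (fun h => lt_irrefl _ (hω ω h)) hωF) hω⟩

theorem activeIn_subset_contract (hAB : AgreeOn S A B) (hl : ω ∉ activeIn K (insert ω S) F B) :
    activeIn K (insert ω S) F B ⊆ activeIn K S (insert ω F) A := by
  intro a ha
  obtain ⟨haS, X, hX, hXa⟩ := mem_activeIn.1 ha
  refine mem_activeIn.2 ⟨(Finset.mem_insert.1 haS).resolve_left ?_, X, hX, hXa.of_insert hAB⟩
  rintro rfl
  exact hl ha

theorem notMem_activeIn_of_not_isLoopIn (hω : ∀ s ∈ S, s < ω) (hl : ¬ IsLoopIn K S F ω) :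
    ω ∉ activeIn K (insert ω S) F B := by
  intro h
  obtain ⟨-, X, hX, hXa⟩ := mem_activeIn.1 h
  exact hl ⟨X, hX, hXa.ne_zero, fun e he =>
    hXa.eq_zero_of_lt e (Finset.mem_insert_of_mem he) (hω e he), hXa.eq_zero⟩

/-- Elimination of `ω` between two signed sets that are nonnegative on `S` and zero below `a`. -/
theorem mem_activeIn_of_elimination (h : IsDualPair K L) {a : E} (haS : a ∈ S) {X X' : SignedSet E}
    (hX : X ∈ K) (hX' : X' ∈ K) (hXa : Activates S (insert ω F) A a X)
    (hnn : ∀ e ∈ S, 0 ≤ X'.reorient A e) (hlt : ∀ e ∈ S, e < a → X' e = 0)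
    (hz : ∀ e, e ∉ S → e ∉ insert ω F → X' e = 0) (hX'ω : X' ω = -X ω) :
    a ∈ activeIn K S F A := by
  obtain ⟨Z, hZ, hZω, hZa, hZg⟩ := h.elimination hX hX' hX'ω hXa.ne_zero (by
    have h1 := hXa.nonneg a haS
    have h2 := hnn a haS
    have h3 := hXa.ne_zero
    unfold SignedSet.reorient at h1 h2
    split_ifs at h1 h2 <;>
    · revert h1 h2 h3
      generalize X a = x
      generalize X' a = y
      revert x y
      decide)
  refine mem_activeIn.2 ⟨haS, Z, hZ, Activates.drop (ω := ω) ⟨?_, ?_, ?_, ?_⟩ hZω⟩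
  · rw [hZa]
    exact hXa.ne_zero
  · intro e he
    have h1 := hXa.nonneg e he
    have h2 := hnn e he
    unfold SignedSet.reorient at h1 h2 ⊢
    rcases hZg e with h | h | h <;> rw [h]
    · split_ifs <;> decide
    · exact h1
    · exact h2
  · intro e he hea
    rcases hZg e with h | h | h <;> rw [h]
    · exact hXa.eq_zero_of_lt e he hea
    · exact hlt e he hea
  · intro e he heF
    rcases hZg e with h | h | h <;> rw [h]
    · exact hXa.eq_zero e he heF
    · exact hz e he heF

/-- Suppose that the largest element `ω` is not a loop. Then the sets of active elements for the
two signs of `ω` are those of the deletion and of the contraction of `ω`, in some order. A sign for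
which the active elements are not those of the deletion gives a signed set through `ω` that is
nonnegative for this sign. -/
theorem activeIn_deletion_contraction (h : IsDualPair K L) (hω : ∀ s ∈ S, s < ω) (hωF : ω ∉ F)
    (hωA : ω ∉ A) (hl : ¬ IsLoopIn K S F ω) :
    (activeIn K (insert ω S) F A = activeIn K S F A ∧
        activeIn K (insert ω S) F (insert ω A) = activeIn K S (insert ω F) A ∨
      activeIn K (insert ω S) F A = activeIn K S (insert ω F) A ∧
        activeIn K (insert ω S) F (insert ω A) = activeIn K S F A) ∧
    ∀ B, AgreeOn S A B → activeIn K (insert ω S) F B ≠ activeIn K S F A →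
      ∃ X ∈ K, X ω ≠ 0 ∧ (∀ e ∈ insert ω S, 0 ≤ X.reorient B e) ∧
        ∀ e, e ∉ insert ω S → e ∉ F → X e = 0 := by
  have hωS : ω ∉ S := fun h => lt_irrefl _ (hω ω h)
  have hA : AgreeOn S A A := AgreeOn.refl S A
  have hB : AgreeOn S A (insert ω A) := AgreeOn.insert A hωS
  have hdel : ∀ B, AgreeOn S A B → activeIn K (insert ω S) F B ≠ activeIn K S F A →
      ∃ a ∈ S, a ∉ activeIn K S F A ∧ ∃ X ∈ K, Activates (insert ω S) F B a X ∧ X ω ≠ 0 := by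
    intro B hAB hne
    obtain ⟨a, ha, haD⟩ := Finset.exists_of_ssubset
      ((activeIn_delete_subset hAB hωF hω).ssubset_of_ne hne.symm)
    obtain ⟨haS, X, hX, hXa⟩ := mem_activeIn.1 ha
    have haS' : a ∈ S := by
      refine (Finset.mem_insert.1 haS).resolve_left ?_
      rintro rfl
      exact notMem_activeIn_of_not_isLoopIn hω hl ha
    refine ⟨a, haS', haD, X, hX, hXa, fun h0 => haD ?_⟩
    exact mem_activeIn.2 ⟨haS', X, hX, (hXa.of_insert hAB).drop h0⟩
  refine ⟨?_, fun B hAB hne => ?_⟩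
  · have hcov : activeIn K S (insert ω F) A ⊆
        activeIn K (insert ω S) F A ∪ activeIn K (insert ω S) F (insert ω A) := by
      intro a ha
      obtain ⟨haS, X, hX, hXa⟩ := mem_activeIn.1 ha
      have key : ∀ B, AgreeOn S A B → 0 ≤ X.reorient B ω → a ∈ activeIn K (insert ω S) F B := by
        intro B hAB hB0
        refine mem_activeIn.2 ⟨Finset.mem_insert_of_mem haS, X, hX, hXa.ne_zero, ?_, ?_, ?_⟩
        · intro e he
          rcases Finset.mem_insert.1 he with rfl | he
          · exact hB0
          · rw [← hAB.reorient X he]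
            exact hXa.nonneg e he
        · intro e he hea
          rcases Finset.mem_insert.1 he with rfl | he
          · exact absurd hea (hω a haS).not_gt
          · exact hXa.eq_zero_of_lt e he hea
        · intro e he heF
          rw [Finset.mem_insert, not_or] at he
          exact hXa.eq_zero e he.2 (by simp [he.1, heF])
      rw [Finset.mem_union]
      rcases SignType.nonneg_or_neg_nonneg (X ω) with h0 | h0
      · exact Or.inl (key A hA (by rwa [SignedSet.reorient_of_notMem hωA]))
      · exact Or.inr (key _ hB (by rwa [SignedSet.reorient_of_mem (Finset.mem_insert_self _ _)]))
    have hsub : ∀ B, AgreeOn S A B → activeIn K (insert ω S) F B ⊆ activeIn K S (insert ω F) A :=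
      fun B hAB => activeIn_subset_contract hAB (notMem_activeIn_of_not_isLoopIn hω hl)
    by_cases hP : activeIn K (insert ω S) F A = activeIn K S F A
    · refine Or.inl ⟨hP, (hsub _ hB).antisymm (hcov.trans ?_)⟩
      rw [hP]
      exact Finset.union_subset (activeIn_delete_subset hB hωF hω) subset_rfl
    by_cases hQ : activeIn K (insert ω S) F (insert ω A) = activeIn K S F A
    · refine Or.inr ⟨(hsub _ hA).antisymm (hcov.trans ?_), hQ⟩
      rw [hQ]
      exact Finset.union_subset subset_rfl (activeIn_delete_subset hA hωF hω)
    -- Otherwise the smaller of two elements active for one sign only is active in the deletion.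
    exfalso
    obtain ⟨a, haS, haD, X, hX, hXa, hXω⟩ := hdel A hA hP
    obtain ⟨b, hbS, hbD, Y, hY, hYb, hYω⟩ := hdel _ hB hQ
    have hX1 : X ω = 1 := by
      have := hXa.nonneg ω (Finset.mem_insert_self _ _)
      rw [SignedSet.reorient_of_notMem hωA] at this
      exact SignType.eq_one_of_nonneg this hXω
    have hY1 : Y ω = -1 := by
      have := hYb.nonneg ω (Finset.mem_insert_self _ _)
      rw [SignedSet.reorient_of_mem (Finset.mem_insert_self _ _)] at this
      revert this hYω
      generalize Y ω = y
      revert y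
      decide
    have hXa' := hXa.of_insert hA
    have hYb' := hYb.of_insert hB
    rcases le_total a b with hab | hab
    · exact haD (mem_activeIn_of_elimination h haS hX hY hXa' hYb'.nonneg
        (fun e he hea => hYb'.eq_zero_of_lt e he (hea.trans_le hab)) hYb'.eq_zero
        (by rw [hX1, hY1]))
    · exact hbD (mem_activeIn_of_elimination h hbS hY hX hYb' hXa'.nonneg
        (fun e he hea => hXa'.eq_zero_of_lt e he (hea.trans_le hab)) hXa'.eq_zero
        (by rw [hX1, hY1]; rfl))
  · obtain ⟨a, -, -, X, hX, hXa, hXω⟩ := hdel B hAB hne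
    exact ⟨X, hX, hXω, hXa.nonneg, hXa.eq_zero⟩

/-- The families `K` and `L` are orthogonal to each other. -/
def OrthogonalFamilies {E : Type*} (K L : Set (SignedSet E)) : Prop :=
  ∀ X ∈ K, ∀ Y ∈ L, (∀ e, 0 ≤ X e * Y e) → ∀ e, X e * Y e = 0

theorem OrthogonalFamilies.symm {E : Type*} {K L : Set (SignedSet E)}
    (h : OrthogonalFamilies K L) : OrthogonalFamilies L K := by
  intro Y hY X hX hnn e
  rw [mul_comm]
  exact h X hX Y hY (fun f => by rw [mul_comm]; exact hnn f) e

theorem OrthogonalFamilies.mul_eq_zero_of_forall_ne {E : Type*} {K L : Set (SignedSet E)}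
    (h : OrthogonalFamilies K L) (hneg : ∀ X ∈ K, -X ∈ K) {X Y : SignedSet E} (hX : X ∈ K)
    (hY : Y ∈ L) {ω : E} (hz : ∀ e, e ≠ ω → X e * Y e = 0) : X ω * Y ω = 0 := by
  have key : ∀ Z ∈ K, (∀ e, e ≠ ω → Z e * Y e = 0) → 0 ≤ Z ω * Y ω → Z ω * Y ω = 0 := by
    intro Z hZ hz h0
    refine h Z hZ Y hY (fun e => ?_) ω
    by_cases he : e = ω
    · rw [he]
      exact h0
    · exact (hz e he).ge
  rcases SignType.nonneg_or_neg_nonneg (X ω * Y ω) with h0 | h0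
  · exact key X hX hz h0
  · have := key (-X) (hneg X hX) (fun e he => by
      rw [Pi.neg_apply, neg_mul, hz e he]
      rfl) (by rwa [Pi.neg_apply, neg_mul])
    rw [Pi.neg_apply, neg_mul] at this
    revert this
    generalize X ω * Y ω = a
    revert a
    decide

/-- A loop is active, and does not change which other elements are active. -/
theorem activeIn_insert_of_isLoopIn (h : IsDualPair K L) (hω : ∀ s ∈ S, s < ω) (hωF : ω ∉ F)
    (hAB : AgreeOn S A B) (hl : IsLoopIn K S F ω) :
    activeIn K (insert ω S) F B = insert ω (activeIn K S F A) := by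
  obtain ⟨X₀, hX₀, hX₀ω, hX₀S, hX₀z⟩ := hl
  have hneg : ∀ X ∈ ({X₀, -X₀} : Set (SignedSet E)),
      X ∈ K ∧ X ω ≠ 0 ∧ (∀ e ∈ S, X e = 0) ∧ ∀ e, e ∉ insert ω S → e ∉ F → X e = 0 := by
    rintro X (rfl | rfl)
    · exact ⟨hX₀, hX₀ω, hX₀S, hX₀z⟩
    · exact ⟨h.neg_left _ hX₀, by simpa using hX₀ω, fun e he => by simp [hX₀S e he],
        fun e he he' => by simp [hX₀z e he he']⟩
  ext a
  rw [Finset.mem_insert]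
  constructor
  · intro ha
    obtain ⟨haS, X, hX, hXa⟩ := mem_activeIn.1 ha
    refine or_iff_not_imp_left.2 fun haω => ?_
    have haS' := (Finset.mem_insert.1 haS).resolve_left haω
    have hXa' := hXa.of_insert hAB
    by_cases hXω : X ω = 0
    · exact mem_activeIn.2 ⟨haS', X, hX, hXa'.drop hXω⟩
    obtain ⟨X', hX', hX'ω⟩ : ∃ X' ∈ ({X₀, -X₀} : Set (SignedSet E)), X' ω = -X ω := by
      by_cases h1 : X₀ ω = -X ω
      · exact ⟨X₀, Or.inl rfl, h1⟩
      · refine ⟨-X₀, Or.inr rfl, ?_⟩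
        rw [Pi.neg_apply]
        revert h1 hXω hX₀ω
        generalize X ω = x
        generalize X₀ ω = y
        revert x y
        decide
    obtain ⟨hX'K, -, hX'S, hX'z⟩ := hneg X' hX'
    refine mem_activeIn_of_elimination h haS' hX hX'K hXa' (fun e he => ?_)
      (fun e he _ => hX'S e he) (fun e he heF => ?_) hX'ω
    · exact (SignedSet.reorient_eq_zero_iff.2 (hX'S e he)).ge
    · rw [Finset.mem_insert, not_or] at heF
      exact hX'z e (by simp [heF.1, he]) heF.2
  · rintro (rfl | ha)
    · obtain ⟨X, hX, hXω⟩ : ∃ X ∈ ({X₀, -X₀} : Set (SignedSet E)), 0 ≤ X.reorient B a := by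
        rcases SignType.nonneg_or_neg_nonneg (X₀.reorient B a) with h0 | h0
        · exact ⟨X₀, Or.inl rfl, h0⟩
        · exact ⟨-X₀, Or.inr rfl, by rwa [SignedSet.reorient_neg]⟩
      obtain ⟨hXK, hXa, hXS, hXz⟩ := hneg X hX
      refine mem_activeIn.2 ⟨Finset.mem_insert_self _ _, X, hXK, hXa, fun e he => ?_,
        fun e he hea => ?_, hXz⟩
      · rcases Finset.mem_insert.1 he with rfl | he
        · exact hXω
        · exact (SignedSet.reorient_eq_zero_iff.2 (hXS e he)).ge
      · rcases Finset.mem_insert.1 he with rfl | he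
        · exact absurd hea (lt_irrefl _)
        · exact hXS e he
    · exact activeIn_delete_subset hAB hωF hω ha

/-- If `ω` is a loop for `K`, then members of the orthogonal family `L` avoid `ω`, so that its
deletion and its contraction have the same dual-active elements. -/
theorem activeIn_eq_of_isLoopIn_orthogonal (hneg : ∀ X ∈ K, -X ∈ K) (hKL : OrthogonalFamilies K L)
    (hω : ∀ s ∈ S, s < ω) (hAB : AgreeOn S A B) (hDF : Disjoint F D) (hωF : ω ∉ F)
    (hSF : Disjoint S F) (hl : IsLoopIn K S F ω) :
    activeIn L (insert ω S) D B = activeIn L S (insert ω D) A := by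
  obtain ⟨X₀, hX₀, hX₀ω, hX₀S, hX₀z⟩ := hl
  have hYω : ∀ Y ∈ L, (∀ e ∈ F, Y e = 0) → Y ω = 0 := by
    intro Y hY hYF
    have := hKL.mul_eq_zero_of_forall_ne hneg hX₀ hY (ω := ω) (fun e he => ?_)
    · rw [mul_comm] at this
      exact SignType.eq_zero_of_mul_eq_zero this hX₀ω
    · by_cases heF : e ∈ F
      · rw [hYF e heF, mul_zero]
      · by_cases heS : e ∈ S
        · rw [hX₀S e heS, zero_mul]
        · rw [hX₀z e (by simp [he, heS]) heF, zero_mul]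
  refine (activeIn_subset_contract hAB ?_).antisymm ?_
  · intro hmem
    obtain ⟨-, Y, hY, hYa⟩ := mem_activeIn.1 hmem
    refine hYa.ne_zero (hYω Y hY fun e he => hYa.eq_zero e ?_ ?_)
    · rw [Finset.mem_insert, not_or]
      refine ⟨?_, fun h => Finset.disjoint_left.1 hSF h he⟩
      rintro rfl
      exact hωF he
    · exact Finset.disjoint_left.1 hDF he
  · intro a ha
    obtain ⟨haS, Y, hY, hYa⟩ := mem_activeIn.1 ha
    have h0 : Y ω = 0 := by
      refine hYω Y hY fun e he => hYa.eq_zero e (fun h => Finset.disjoint_left.1 hSF h he) ?_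
      rw [Finset.mem_insert, not_or]
      refine ⟨?_, Finset.disjoint_left.1 hDF he⟩
      rintro rfl
      exact hωF he
    exact mem_activeIn.2 ⟨Finset.mem_insert_of_mem haS, Y, hY,
      hYa.insert_of_eq_zero hAB subset_rfl h0 hω⟩

end ActiveIn

/-! ### The recursion for the activities of reorientations -/

section ActivitySum

variable {E : Type*} [LinearOrder E] {K L K' L' : Set (SignedSet E)} {S C D : Finset E} {ω : E}
  {R : Type*} [CommRing R]

/-- The generating function of the numbers of dual-active and active elements of the
reorientations of the minor with ground set `S` obtained by contracting `C` and deleting `D`. -/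
noncomputable def activitySum (K L : Set (SignedSet E)) (S C D : Finset E) (u v : R) : R :=
  ∑ A ∈ S.powerset, u ^ (activeIn L S D A).card * v ^ (activeIn K S C A).card

theorem activitySum_swap (K L : Set (SignedSet E)) (S C D : Finset E) (u v : R) :
    activitySum K L S C D u v = activitySum L K S D C v u :=
  Finset.sum_congr rfl fun _ _ => mul_comm _ _

/-- Deletion and contraction of the largest element `ω`. If for one sign of `ω` the active elements
were those of the contraction and the dual-active elements those of the deletion, both more than
for the other minor, there would be a positive circuit and a positive cocircuit through `ω`. -/
theorem activitySum_insert (hK : IsDualPair K K') (hL : IsDualPair L L')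
    (hKL : OrthogonalFamilies K L) (hω : ∀ s ∈ S, s < ω) (hCD : Disjoint C D) (hωC : ω ∉ C)
    (hωD : ω ∉ D) (hlK : ¬ IsLoopIn K S C ω) (hlL : ¬ IsLoopIn L S D ω) (u v : R) :
    activitySum K L (insert ω S) C D u v =
      activitySum K L S C (insert ω D) u v + activitySum K L S (insert ω C) D u v := by
  have hωS : ω ∉ S := fun h => lt_irrefl _ (hω ω h)
  unfold activitySum
  rw [Finset.sum_powerset_insert hωS, ← Finset.sum_add_distrib, ← Finset.sum_add_distrib]
  refine Finset.sum_congr rfl fun A hA => ?_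
  have hωA : ω ∉ A := fun h => hωS (Finset.mem_powerset.1 hA h)
  obtain ⟨hK₁, hK₂⟩ := activeIn_deletion_contraction hK hω hωC hωA hlK
  obtain ⟨hL₁, hL₂⟩ := activeIn_deletion_contraction hL hω hωD hωA hlL
  have hbad : ∀ B, AgreeOn S A B → activeIn K (insert ω S) C B ≠ activeIn K S C A →
      activeIn L (insert ω S) D B ≠ activeIn L S D A → False := by
    intro B hAB h1 h2
    obtain ⟨X, hX, hXω, hXS, hXz⟩ := hK₂ B hAB h1
    obtain ⟨Y, hY, hYω, hYS, hYz⟩ := hL₂ B hAB h2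
    have := hKL X hX Y hY (fun e => ?_) ω
    · exact hXω (SignType.eq_zero_of_mul_eq_zero this hYω)
    · by_cases heS : e ∈ insert ω S
      · rw [← SignedSet.reorient_mul_reorient B]
        exact SignType.mul_nonneg' (hXS e heS) (hYS e heS)
      · by_cases heC : e ∈ C
        · rw [hYz e heS (Finset.disjoint_left.1 hCD heC), mul_zero]
        · rw [hXz e heS heC, zero_mul]
  have hbad₁ := hbad A (AgreeOn.refl S A)
  have hbad₂ := hbad _ (AgreeOn.insert A hωS)
  rcases hK₁ with ⟨h1, h2⟩ | ⟨h1, h2⟩ <;> rcases hL₁ with ⟨h3, h4⟩ | ⟨h3, h4⟩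
  · rw [h2, h4] at hbad₂
    rw [h1, h2, h3, h4]
    by_cases h5 : activeIn K S (insert ω C) A = activeIn K S C A
    · rw [h5, add_comm]
    · rw [not_not.1 fun h => hbad₂ h5 h]
  · rw [h1, h2, h3, h4]
  · rw [h1, h2, h3, h4, add_comm]
  · rw [h1, h3] at hbad₁
    rw [h1, h2, h3, h4]
    by_cases h5 : activeIn K S (insert ω C) A = activeIn K S C A
    · rw [h5, add_comm]
    · rw [not_not.1 fun h => hbad₁ h5 h, add_comm]

theorem activitySum_insert_of_isLoopIn (hK : IsDualPair K K') (hKL : OrthogonalFamilies K L)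
    (hω : ∀ s ∈ S, s < ω) (hCD : Disjoint C D) (hSC : Disjoint S C) (hωC : ω ∉ C)
    (hl : IsLoopIn K S C ω) (u v : R) :
    activitySum K L (insert ω S) C D u v = 2 * v * activitySum K L S C (insert ω D) u v := by
  have hωS : ω ∉ S := fun h => lt_irrefl _ (hω ω h)
  unfold activitySum
  rw [Finset.sum_powerset_insert hωS, ← Finset.sum_add_distrib, Finset.mul_sum]
  refine Finset.sum_congr rfl fun A hA => ?_
  have key : ∀ B, AgreeOn S A B →
      u ^ (activeIn L (insert ω S) D B).card * v ^ (activeIn K (insert ω S) C B).card =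
        v * (u ^ (activeIn L S (insert ω D) A).card * v ^ (activeIn K S C A).card) := by
    intro B hAB
    rw [activeIn_eq_of_isLoopIn_orthogonal hK.neg_left hKL hω hAB hCD hωC hSC hl,
      activeIn_insert_of_isLoopIn hK hω hωC hAB hl, Finset.card_insert_of_notMem
        (fun h => hωS (mem_activeIn.1 h).1)]
    ring
  rw [key A (AgreeOn.refl S A), key _ (AgreeOn.insert A hωS)]
  ring

theorem activitySum_insert_of_isLoopIn_right (hL : IsDualPair L L')
    (hKL : OrthogonalFamilies K L) (hω : ∀ s ∈ S, s < ω) (hCD : Disjoint C D) (hSD : Disjoint S D)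
    (hωD : ω ∉ D) (hl : IsLoopIn L S D ω) (u v : R) :
    activitySum K L (insert ω S) C D u v = 2 * u * activitySum K L S (insert ω C) D u v := by
  rw [activitySum_swap, activitySum_swap K,
    activitySum_insert_of_isLoopIn hL hKL.symm hω hCD.symm hSD hωD hl]

end ActivitySum

namespace OrientedMatroid

/-! ### Rank and perspectives -/

section Rank

variable {E : Type*} (M N : OrientedMatroid E)

/-- Some circuit contains `e` and is contained in `insert e A`; for `e ∉ A` this says that `e` lies
in the closure of `A`. -/
def Spans (A : Set E) (e : E) : Prop := ∃ X ∈ M.circuits, X e ≠ 0 ∧ ∀ f, X f ≠ 0 → f = e ∨ f ∈ A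

variable {M N}

theorem Spans.mono {A B : Set E} {e : E} (h : M.Spans A e) (hAB : A ⊆ B) : M.Spans B e := by
  obtain ⟨X, hX, hXe, hXA⟩ := h
  exact ⟨X, hX, hXe, fun f hf => (hXA f hf).imp_right fun h => hAB h⟩

theorem IsPerspective.spans (h : M.IsPerspective N) {A : Set E} {e : E} (hA : M.Spans A e) :
    N.Spans A e := by
  obtain ⟨X, hX, hXe, hXA⟩ := hA
  obtain ⟨Y, hY, hYe, hYX⟩ := h X hX e hXe
  exact ⟨Y, hY, hYe ▸ hXe, fun f hf => hXA f (hYX f hf ▸ hf)⟩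

theorem IsPerspective.orthogonalFamilies [Finite E] (h : M.IsPerspective N) :
    OrthogonalFamilies M.circuits N.cocircuits := by
  intro X hX Y hY hnn e
  by_cases hXe : X e = 0
  · rw [hXe, zero_mul]
  obtain ⟨Z, hZ, hZe, hZX⟩ := h X hX e hXe
  rw [← hZe]
  refine N.isDualPair.orth Z hZ Y hY (fun f => ?_) e
  by_cases hZf : Z f = 0
  · rw [hZf, zero_mul]
  · rw [hZX f hZf]
    exact hnn f

variable [Finite E]

theorem rk_mono {A B : Set E} (h : A ⊆ B) : M.rk A ≤ M.rk B := by
  refine ENat.toNat_le_toNat (M.toMatroid.eRk_mono h) ?_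
  exact ((M.toMatroid.eRk_le_encard B).trans_lt (Set.toFinite B).encard_lt_top).ne

theorem cast_rk (A : Set E) : ((M.rk A : ℕ) : ℕ∞) = M.toMatroid.eRk A :=
  ENat.natCast_toNat ((M.toMatroid.eRk_le_encard A).trans_lt (Set.toFinite A).encard_lt_top).ne

theorem rk_insert_of_spans {A : Set E} {e : E} (h : M.Spans A e) : M.rk (insert e A) = M.rk A := by
  by_cases heA : e ∈ A
  · rw [Set.insert_eq_of_mem heA]
  have hcl : e ∈ M.toMatroid.closure A := by
    obtain ⟨X, hX, hXe, hXA⟩ := h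
    obtain ⟨I, hI, hIs⟩ := Matroid.Indep.subset_isBasis_of_subset
      (M := M.toMatroid) (I := Function.support X \ {e}) (X := A) (by
        rw [toMatroid_indep_iff]
        intro Z hZ hs
        have hss := hs.trans Set.sdiff_subset
        rcases M.eq_or_eq_neg Z hZ X hX hss with rfl | rfl
        · exact (hs hXe).2 rfl
        · exact (hs (show (-X) e ≠ 0 by simpa using hXe)).2 rfl)
      (fun f hf => (hXA f hf.1).resolve_left hf.2) (Set.subset_univ A)
    rw [← hI.closure_eq_closure]
    by_contra hcl
    have := (M.toMatroid_indep_iff.1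
      ((hI.indep.notMem_closure_iff (Set.mem_univ e)).1 hcl).1) X hX
    refine this fun f hf => ?_
    by_cases hfe : f = e
    · exact Or.inl hfe
    · exact Or.inr (hIs ⟨hf, hfe⟩)
  rw [rk, rk, ← Matroid.eRk_insert_closure_eq, Set.insert_eq_of_mem hcl,
    Matroid.eRk_closure_eq]

theorem rk_insert_of_not_spans {A : Set E} {e : E} (heA : e ∉ A) (h : ¬ M.Spans A e) :
    M.rk (insert e A) = M.rk A + 1 := by
  have hcl : e ∉ M.toMatroid.closure A := by
    intro hcl
    obtain ⟨I, hI⟩ := M.toMatroid.exists_isBasis A (Set.subset_univ A)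
    rw [← hI.closure_eq_closure] at hcl
    refine (hI.indep.notMem_closure_iff (Set.mem_univ e)).2 ⟨?_, fun h => heA (hI.subset h)⟩ hcl
    rw [toMatroid_indep_iff]
    intro X hX hs
    refine h ⟨X, hX, ?_, fun f hf => (hs hf).imp_right fun h => hI.subset h⟩
    intro h0
    refine M.toMatroid_indep_iff.1 hI.indep X hX fun f hf => (hs hf).resolve_left ?_
    rintro rfl
    exact hf h0
  have := M.toMatroid.eRk_insert_eq_add_one (e := e) (X := A) ⟨Set.mem_univ e, hcl⟩
  rw [← cast_rk, ← cast_rk] at this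
  exact_mod_cast this

theorem rk_insert_le {A : Set E} {e : E} : M.rk (insert e A) ≤ M.rk A + 1 := by
  by_cases heA : e ∈ A
  · rw [Set.insert_eq_of_mem heA]
    exact Nat.le_succ _
  · by_cases h : M.Spans A e
    · rw [rk_insert_of_spans h]
      exact Nat.le_succ _
    · rw [rk_insert_of_not_spans heA h]

theorem rk_union_le [DecidableEq E] (A C : Finset E) :
    M.rk ↑(A ∪ C) ≤ A.card + M.rk ↑C := by
  induction A using Finset.induction_on with
  | empty => simp
  | insert e A he ih =>
    rw [Finset.insert_union, Finset.coe_insert, Finset.card_insert_of_notMem he]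
    have := rk_insert_le (M := M) (A := ↑(A ∪ C)) (e := e)
    omega

end Rank

/-! ### The recursion for the rank generating function -/

section TutteSum

variable {E : Type*} [Finite E] [LinearOrder E] {M N : OrientedMatroid E} {S C D : Finset E} {ω : E}
  {R : Type*} [CommRing R]

/-- The rank generating function, with the third variable equal to `1`, of the minor with ground set
`S` obtained by contracting `C` and deleting the other elements. -/
noncomputable def tutteSum (M N : OrientedMatroid E) (S C : Finset E) (x y : R) : R :=
  ∑ A ∈ S.powerset, (x - 1) ^ (N.rk ↑(S ∪ C) - N.rk ↑(A ∪ C)) *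
    (y - 1) ^ (A.card + M.rk ↑C - M.rk ↑(A ∪ C))

theorem tutteSum_term_delete {A : Finset E} {d : ℕ}
    (hA : A ⊆ S) (hd : N.rk ↑(insert ω (S ∪ C)) = N.rk ↑(S ∪ C) + d) (x y : R) :
    (x - 1) ^ (N.rk ↑(insert ω S ∪ C) - N.rk ↑(A ∪ C)) *
        (y - 1) ^ (A.card + M.rk ↑C - M.rk ↑(A ∪ C)) =
      (x - 1) ^ d * ((x - 1) ^ (N.rk ↑(S ∪ C) - N.rk ↑(A ∪ C)) *
        (y - 1) ^ (A.card + M.rk ↑C - M.rk ↑(A ∪ C))) := by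
  have hle : N.rk ↑(A ∪ C) ≤ N.rk ↑(S ∪ C) :=
    rk_mono (Finset.coe_subset.2 (Finset.union_subset_union_left hA))
  rw [Finset.insert_union, hd, ← mul_assoc, ← pow_add]
  congr 2
  omega

theorem tutteSum_term_contract {A : Finset E} {d : ℕ} (hωA : ω ∉ A)
    (hd : M.rk ↑(insert ω C) + d = M.rk ↑C + 1) (x y : R) :
    (x - 1) ^ (N.rk ↑(insert ω S ∪ C) - N.rk ↑(insert ω A ∪ C)) *
        (y - 1) ^ ((insert ω A).card + M.rk ↑C - M.rk ↑(insert ω A ∪ C)) =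
      (y - 1) ^ d * ((x - 1) ^ (N.rk ↑(S ∪ insert ω C) - N.rk ↑(A ∪ insert ω C)) *
        (y - 1) ^ (A.card + M.rk ↑(insert ω C) - M.rk ↑(A ∪ insert ω C))) := by
  have hle := rk_union_le (M := M) A (insert ω C)
  rw [mul_left_comm, ← pow_add, Finset.insert_union, Finset.insert_union,
    Finset.union_insert, Finset.union_insert, Finset.card_insert_of_notMem hωA]
  rw [Finset.union_insert] at hle
  congr 2
  omega

/-- The recursion for the rank generating function; `d` and `d'` are `0` in the generic case. -/
theorem tutteSum_insert {d d' : ℕ} (hω : ω ∉ S)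
    (hd : N.rk ↑(insert ω (S ∪ C)) = N.rk ↑(S ∪ C) + d)
    (hd' : M.rk ↑(insert ω C) + d' = M.rk ↑C + 1) (x y : R) :
    tutteSum M N (insert ω S) C x y =
      (x - 1) ^ d * tutteSum M N S C x y + (y - 1) ^ d' * tutteSum M N S (insert ω C) x y := by
  unfold tutteSum
  rw [Finset.sum_powerset_insert hω, Finset.mul_sum, Finset.mul_sum]
  congr 1
  · exact Finset.sum_congr rfl fun A hA =>
      tutteSum_term_delete (Finset.mem_powerset.1 hA) hd x y
  · exact Finset.sum_congr rfl fun A hA =>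
      tutteSum_term_contract (fun h => hω (Finset.mem_powerset.1 hA h)) hd' x y

theorem tutteSum_contract_eq {d d' : ℕ}
    (hM : ∀ A ⊆ S, M.rk ↑(insert ω (A ∪ C)) = M.rk ↑(A ∪ C) + d)
    (hN : ∀ A ⊆ S, N.rk ↑(insert ω (A ∪ C)) = N.rk ↑(A ∪ C) + d') (x y : R) :
    tutteSum M N S (insert ω C) x y = tutteSum M N S C x y := by
  unfold tutteSum
  refine Finset.sum_congr rfl fun A hA => ?_
  have hC := hM ∅ (Finset.empty_subset _)
  rw [Finset.empty_union] at hC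
  rw [Finset.union_insert, Finset.union_insert, hN S subset_rfl, hN A (Finset.mem_powerset.1 hA),
    hM A (Finset.mem_powerset.1 hA), hC]
  congr 2 <;> omega

theorem tutteSum_insert_of_isLoopIn (hMN : M.IsPerspective N) (hω : ω ∉ S)
    (hl : IsLoopIn M.circuits S C ω) (x y : R) :
    tutteSum M N (insert ω S) C x y = y * tutteSum M N S C x y := by
  have hsp : M.Spans ↑C ω := by
    obtain ⟨X, hX, hXω, hXS, hXz⟩ := hl
    refine ⟨X, hX, hXω, fun f hf => ?_⟩
    by_contra h
    rw [not_or] at h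
    refine hf (hXz f ?_ h.2)
    rw [Finset.mem_insert, not_or]
    exact ⟨h.1, fun hfS => hf (hXS f hfS)⟩
  have hsub : ∀ A : Finset E, (↑C : Set E) ⊆ ↑(A ∪ C) := fun A =>
    Finset.coe_subset.2 Finset.subset_union_right
  have hM : ∀ A ⊆ S, M.rk ↑(insert ω (A ∪ C)) = M.rk ↑(A ∪ C) + 0 := fun A _ => by
    rw [Finset.coe_insert, rk_insert_of_spans (hsp.mono (hsub A)), add_zero]
  have hN : ∀ A ⊆ S, N.rk ↑(insert ω (A ∪ C)) = N.rk ↑(A ∪ C) + 0 := fun A _ => by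
    rw [Finset.coe_insert, rk_insert_of_spans ((hMN.spans hsp).mono (hsub A)), add_zero]
  have hC := hM ∅ (Finset.empty_subset _)
  rw [Finset.empty_union] at hC
  rw [tutteSum_insert (d' := 1) hω (hN S subset_rfl) (by rw [hC]), tutteSum_contract_eq hM hN]
  ring

theorem tutteSum_insert_of_isLoopIn_right (hMN : M.IsPerspective N) (hω : ω ∉ S) (hωC : ω ∉ C)
    (hSC : Disjoint S C) (hCD : Disjoint C D)
    (hl : IsLoopIn N.cocircuits S D ω) (x y : R) :
    tutteSum M N (insert ω S) C x y = x * tutteSum M N S (insert ω C) x y := by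
  have hsp : ¬ N.Spans ↑(S ∪ C) ω := by
    rintro ⟨X, hX, hXω, hXS⟩
    obtain ⟨Y, hY, hYω, hYS, hYz⟩ := hl
    have h := OrthogonalFamilies.mul_eq_zero_of_forall_ne (K := N.circuits) (L := N.cocircuits)
      N.isDualPair.orth N.neg_mem hX hY (ω := ω) (fun e he => ?_)
    · exact hXω (SignType.eq_zero_of_mul_eq_zero h hYω)
    · by_cases hXe : X e = 0
      · rw [hXe, zero_mul]
      have := (hXS e hXe).resolve_left he
      rw [Finset.coe_union] at this
      rcases this with h | h
      · rw [hYS e h, mul_zero]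
      · rw [hYz e (fun h' => ?_) (Finset.disjoint_left.1 hCD h), mul_zero]
        exact Finset.disjoint_left.1 hSC ((Finset.mem_insert.1 h').resolve_left he) h
  have hsub : ∀ A ⊆ S, (↑(A ∪ C) : Set E) ⊆ ↑(S ∪ C) := fun A hA =>
    Finset.coe_subset.2 (Finset.union_subset_union_left hA)
  have hω' : ∀ A ⊆ S, ω ∉ (↑(A ∪ C) : Set E) := by
    intro A hA h
    rcases Finset.mem_union.1 h with h | h
    · exact hω (hA h)
    · exact hωC h
  have hN : ∀ A ⊆ S, N.rk ↑(insert ω (A ∪ C)) = N.rk ↑(A ∪ C) + 1 := fun A hA => by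
    rw [Finset.coe_insert, rk_insert_of_not_spans (hω' A hA) fun h => hsp (h.mono (hsub A hA))]
  have hM : ∀ A ⊆ S, M.rk ↑(insert ω (A ∪ C)) = M.rk ↑(A ∪ C) + 1 := fun A hA => by
    rw [Finset.coe_insert, rk_insert_of_not_spans (hω' A hA)
      fun h => hsp ((hMN.spans h).mono (hsub A hA))]
  have hC := hM ∅ (Finset.empty_subset _)
  rw [Finset.empty_union] at hC
  rw [tutteSum_insert (d' := 0) hω (hN S subset_rfl) (by rw [hC]), tutteSum_contract_eq hM hN]
  ring

theorem tutteSum_insert_of_not_isLoopIn (hω : ω ∉ S) (hωC : ω ∉ C) (hSC : Disjoint S C)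
    (hD : ∀ e, e ∉ insert ω S → e ∉ D → e ∈ C)
    (hlM : ¬ IsLoopIn M.circuits S C ω) (hlN : ¬ IsLoopIn N.cocircuits S D ω) (x y : R) :
    tutteSum M N (insert ω S) C x y =
      tutteSum M N S C x y + tutteSum M N S (insert ω C) x y := by
  have hM : ¬ M.Spans ↑C ω := by
    rintro ⟨X, hX, hXω, hXC⟩
    refine hlM ⟨X, hX, hXω, fun e he => ?_, fun e he heC => ?_⟩
    · by_contra hXe
      rcases hXC e hXe with rfl | h
      · exact hω he
      · exact Finset.disjoint_left.1 hSC he h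
    · by_contra hXe
      rcases hXC e hXe with rfl | h
      · exact he (Finset.mem_insert_self _ _)
      · exact heC h
  have hN : N.Spans ↑(S ∪ C) ω := by
    rcases N.isDualPair.painting (fun e => if e = ω then 1 else 0) ↑(S ∪ C) ω (by simp) with
      ⟨X, hX, hXω, -, hXz⟩ | ⟨Y, hY, hYω, -, hYz⟩
    · refine ⟨X, hX, by simp [hXω], fun f hf => ?_⟩
      by_contra h
      rw [not_or] at h
      exact hf (hXz f h.2 (if_neg h.1))
    · exfalso
      refine hlN ⟨Y, hY, by simp [hYω], fun e he => ?_, fun e he heD => ?_⟩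
      · refine hYz e (Finset.mem_union_left _ he) (if_neg ?_)
        rintro rfl
        exact hω he
      · refine hYz e (Finset.mem_union_right _ (hD e he heD)) (if_neg ?_)
        rintro rfl
        exact he (Finset.mem_insert_self _ _)
  have h := tutteSum_insert (M := M) (N := N) (C := C) (d := 0) (d' := 0) hω
    (by rw [Finset.coe_insert, rk_insert_of_spans hN, add_zero])
    (by rw [Finset.coe_insert, rk_insert_of_not_spans hωC hM, add_zero]) x y
  simpa using h

/-- The rank generating function and the generating function of the activities of reorientations
satisfy the same recursion on the largest element. -/
theorem tutteSum_two_mul (hMN : M.IsPerspective N) (u v : R) (S : Finset E) :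
    ∀ C D : Finset E, Disjoint S C → Disjoint S D → Disjoint C D →
      (∀ e, e ∉ S → e ∉ D → e ∈ C) →
      tutteSum M N S C (2 * u) (2 * v) = activitySum M.circuits N.cocircuits S C D u v := by
  induction S using Finset.induction_on_max with
  | empty =>
    intro C D _ _ _ _
    have h : ∀ (K : Set (SignedSet E)) (F A : Finset E), activeIn K ∅ F A = ∅ := fun K F A =>
      Finset.eq_empty_of_forall_notMem fun a ha => by simpa using (mem_activeIn.1 ha).1
    simp [tutteSum, activitySum, h]
  | insert ω S hω ih =>
    intro C D hSC hSD hCD hcov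
    have hωS : ω ∉ S := fun h => lt_irrefl _ (hω ω h)
    rw [Finset.disjoint_insert_left] at hSC hSD
    obtain ⟨hωC, hSC⟩ := hSC
    obtain ⟨hωD, hSD⟩ := hSD
    have hdel : tutteSum M N S C (2 * u) (2 * v) =
        activitySum M.circuits N.cocircuits S C (insert ω D) u v := by
      refine ih C (insert ω D) hSC ?_ ?_ fun e he he' => hcov e ?_ ?_
      · exact Finset.disjoint_insert_right.2 ⟨hωS, hSD⟩
      · exact Finset.disjoint_insert_right.2 ⟨hωC, hCD⟩
      · rw [Finset.mem_insert, not_or] at he' ⊢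
        exact ⟨he'.1, he⟩
      · exact fun h => he' (Finset.mem_insert_of_mem h)
    have hcon : tutteSum M N S (insert ω C) (2 * u) (2 * v) =
        activitySum M.circuits N.cocircuits S (insert ω C) D u v := by
      refine ih (insert ω C) D ?_ hSD ?_ fun e he he' => ?_
      · exact Finset.disjoint_insert_right.2 ⟨hωS, hSC⟩
      · exact Finset.disjoint_insert_left.2 ⟨hωD, hCD⟩
      · by_cases heω : e = ω
        · exact Finset.mem_insert.2 (Or.inl heω)
        · exact Finset.mem_insert_of_mem (hcov e (by simp [heω, he]) he')
    have hKL := hMN.orthogonalFamilies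
    by_cases hlM : IsLoopIn M.circuits S C ω
    · rw [tutteSum_insert_of_isLoopIn hMN hωS hlM, hdel,
        activitySum_insert_of_isLoopIn M.isDualPair hKL hω hCD hSC hωC hlM]
    by_cases hlN : IsLoopIn N.cocircuits S D ω
    · rw [tutteSum_insert_of_isLoopIn_right hMN hωS hωC hSC hCD hlN, hcon,
        activitySum_insert_of_isLoopIn_right N.isDualPair.symm hKL hω hCD hSD hωD hlN]
    · rw [tutteSum_insert_of_not_isLoopIn hωS hωC hSC hcov hlM hlN, hdel, hcon,
        activitySum_insert M.isDualPair N.isDualPair.symm hKL hω hCD hωC hωD hlM hlN]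

end TutteSum

end OrientedMatroid

/-! ### Active partitions and their reorientation -/

section Reorient

variable {E : Type*} [DecidableEq E] {K L : Set (SignedSet E)} {W : Finset E}

/-- The family `K` reoriented along `A`. -/
def reorientFamily (A : Finset E) (K : Set (SignedSet E)) : Set (SignedSet E) :=
  {X | X.reorient A ∈ K}

theorem reorient_mem_reorientFamily {X : SignedSet E} (hX : X ∈ K) :
    X.reorient W ∈ reorientFamily W K := by
  change (X.reorient W).reorient W ∈ K
  rwa [SignedSet.reorient_reorient_self]

theorem OrthogonalFamilies.reorientFamily (h : OrthogonalFamilies K L) (A : Finset E) :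
    OrthogonalFamilies (reorientFamily A K) (reorientFamily A L) := by
  intro X hX Y hY hnn e
  rw [← SignedSet.reorient_mul_reorient A]
  exact h _ hX _ hY (fun f => by rw [SignedSet.reorient_mul_reorient]; exact hnn f) e

theorem IsDualPair.reorientFamily (h : IsDualPair K L) (A : Finset E) :
    IsDualPair (reorientFamily A K) (reorientFamily A L) where
  neg_left X hX := by
    change (-X).reorient A ∈ K
    rw [SignedSet.reorient_neg]
    exact h.neg_left _ hX
  neg_right Y hY := by
    change (-Y).reorient A ∈ L
    rw [SignedSet.reorient_neg]
    exact h.neg_right _ hY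
  orth := OrthogonalFamilies.reorientFamily (K := K) (L := L) h.orth A
  painting σ R e he := by
    have hσ : ∀ f, SignedSet.reorient A σ f = 0 ↔ σ f = 0 := fun f =>
      SignedSet.reorient_eq_zero_iff
    have hmul : ∀ (X : SignedSet E) f,
        σ f * X.reorient A f = SignedSet.reorient A σ f * X f := fun X f => by
      rw [← SignedSet.reorient_mul_reorient A, SignedSet.reorient_reorient_self]
    have hval : ∀ X : SignedSet E, X e = SignedSet.reorient A σ e → X.reorient A e = σ e := by
      intro X hX
      unfold SignedSet.reorient at hX ⊢
      split_ifs at hX ⊢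
      · rw [hX, neg_neg]
      · exact hX
    rcases h.painting (SignedSet.reorient A σ) R e ((hσ e).not.2 he) with
      ⟨X, hX, h₁, h₂, h₃⟩ | ⟨X, hX, h₁, h₂, h₃⟩
    · refine Or.inl ⟨X.reorient A, reorient_mem_reorientFamily hX, hval X h₁, fun f => ?_,
        fun f hf h0 => SignedSet.reorient_eq_zero_iff.2 (h₃ f hf ((hσ f).2 h0))⟩
      rw [hmul]
      exact h₂ f
    · refine Or.inr ⟨X.reorient A, reorient_mem_reorientFamily hX, hval X h₁, fun f => ?_,
        fun f hf h0 => SignedSet.reorient_eq_zero_iff.2 (h₃ f hf ((hσ f).2 h0))⟩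
      rw [hmul]
      exact h₂ f

/-- Reorienting along a set that contains or avoids `P` can be done up to a global sign without
changing the signs on `P`. -/
theorem exists_reorient_eq {P : Finset E} (hP : P ⊆ W ∨ Disjoint P W) (hneg : ∀ X ∈ K, -X ∈ K)
    {X : SignedSet E} (hX : X.reorient W ∈ K) :
    ∃ Z ∈ K, (∀ f ∈ P, Z f = X f) ∧ ∀ f, X f = 0 → Z f = 0 := by
  rcases hP with hP | hP
  · refine ⟨-X.reorient W, hneg _ hX, fun f hf => ?_, fun f hf => ?_⟩
    · rw [Pi.neg_apply, SignedSet.reorient_of_mem (hP hf), neg_neg]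
    · rw [Pi.neg_apply, SignedSet.reorient_eq_zero_iff.2 hf]
      rfl
  · exact ⟨_, hX, fun f hf => SignedSet.reorient_of_notMem (Finset.disjoint_left.1 hP hf) X,
      fun f hf => SignedSet.reorient_eq_zero_iff.2 hf⟩

end Reorient

section Parts

variable {E : Type*} {e : E}

/-- Suppose that `Z` is nonnegative outside a set `T` which is covered by positive members of `J`
vanishing on `I`, where `Z` vanishes as well. Then the support of `Z` is covered by such members:
a member of `J'` that separates an element `e` of `Z` from them, by the painting property, would
vanish on `T` and conform to `Z`. -/
theorem exists_positive_of_nonneg_on_part {J J' : Set (SignedSet E)} (h : IsDualPair J J')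
    {Z : SignedSet E} (hZ : Z ∈ J) {I T : Set E} (hZI : ∀ f ∈ I, Z f = 0)
    (hT : ∀ f ∈ T, ∃ X ∈ J, X.IsPositive ∧ (∀ g ∈ I, X g = 0) ∧ X f ≠ 0)
    (hnn : ∀ f ∉ T, 0 ≤ Z f) (he : Z e ≠ 0) :
    ∃ X ∈ J, X.IsPositive ∧ (∀ g ∈ I, X g = 0) ∧ X e ≠ 0 := by
  classical
  by_cases heT : e ∈ T
  · exact hT e heT
  have heI : e ∉ I := fun h => he (hZI e h)
  rcases h.painting (fun f => if f ∈ I then 0 else 1) ∅ e (by simp [heI]) with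
    ⟨X, hX, hXe, hX1, hX2⟩ | ⟨Y, hY, hYe, hY1, -⟩
  · have hz : ∀ g ∈ I, X g = 0 := fun g hg => hX2 g (Set.notMem_empty g) (if_pos hg)
    refine ⟨X, hX, fun f => ?_, hz, by simp [hXe, heI]⟩
    by_cases hf : f ∈ I
    · exact (hz f hf).ge
    · simpa [hf] using hX1 f
  · exfalso
    have hY0 : ∀ f ∉ I, 0 ≤ Y f := fun f hf => by simpa [hf] using hY1 f
    have hYT : ∀ f ∈ T, Y f = 0 := by
      intro f hf
      obtain ⟨X, hX, hXpos, hXI, hXf⟩ := hT f hf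
      have := h.orth X hX Y hY (fun g => ?_) f
      · rw [mul_comm] at this
        exact SignType.eq_zero_of_mul_eq_zero this hXf
      · by_cases hg : g ∈ I
        · rw [hXI g hg, zero_mul]
        · exact SignType.mul_nonneg' (hXpos g) (hY0 g hg)
    have := h.orth Z hZ Y hY (fun g => ?_) e
    · rw [hYe, if_neg heI, mul_one] at this
      exact he this
    · by_cases hg : g ∈ T
      · rw [hYT g hg, mul_zero]
      by_cases hgI : g ∈ I
      · rw [hZI g hgI, zero_mul]
      · exact SignType.mul_nonneg' (hnn g hg) (hY0 g hgI)

variable [Fintype E] [LinearOrder E]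

open Classical in
/-- The union of the positive members of `K` whose smallest element is in `S`. -/
noncomputable def posUnion (K : Set (SignedSet E)) (S : Set E) : Finset E :=
  {e | ∃ X ∈ K, X.IsPositive ∧ (∃ a ∈ S, IsLeast (Function.support X) a) ∧ X e ≠ 0}

/-- The part with smallest element `a` of the active partition defined by `K`. -/
noncomputable def activePart (K : Set (SignedSet E)) (a : E) : Finset E :=
  posUnion K (Set.Ici a) \ posUnion K (Set.Ioi a)

open Classical in
/-- The smallest elements of the positive members of `K`. -/
noncomputable def minPos (K : Set (SignedSet E)) : Finset E :=
  {a | ∃ X ∈ K, X.IsPositive ∧ IsLeast (Function.support X) a}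

variable {K L K' L' : Set (SignedSet E)} {W : Finset E} {a b : E}

theorem exists_isLeast_support {X : SignedSet E} (h : X e ≠ 0) :
    ∃ a, IsLeast (Function.support X) a := by
  obtain ⟨a, ha, hmin⟩ := Set.exists_min_image (Function.support X) id (Set.toFinite _) ⟨e, h⟩
  exact ⟨a, ha, hmin⟩

theorem mem_posUnion {S : Set E} : e ∈ posUnion K S ↔
    ∃ X ∈ K, X.IsPositive ∧ (∃ a ∈ S, IsLeast (Function.support X) a) ∧ X e ≠ 0 := by
  simp [posUnion]

theorem mem_posUnion_Ici :
    e ∈ posUnion K (Set.Ici a) ↔ ∃ X ∈ K, X.IsPositive ∧ (∀ f < a, X f = 0) ∧ X e ≠ 0 := by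
  rw [mem_posUnion]
  constructor
  · rintro ⟨X, hX, hpos, ⟨c, hc, hmin⟩, he⟩
    refine ⟨X, hX, hpos, fun f hf => ?_, he⟩
    by_contra h
    exact absurd (hf.trans_le hc) (hmin.2 h).not_gt
  · rintro ⟨X, hX, hpos, hz, he⟩
    obtain ⟨c, hc⟩ := exists_isLeast_support he
    exact ⟨X, hX, hpos, ⟨c, not_lt.1 fun h => hc.1 (hz c h), hc⟩, he⟩

theorem mem_posUnion_Ioi :
    e ∈ posUnion K (Set.Ioi a) ↔ ∃ X ∈ K, X.IsPositive ∧ (∀ f ≤ a, X f = 0) ∧ X e ≠ 0 := by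
  rw [mem_posUnion]
  constructor
  · rintro ⟨X, hX, hpos, ⟨c, hc, hmin⟩, he⟩
    refine ⟨X, hX, hpos, fun f hf => ?_, he⟩
    by_contra h
    exact absurd (hf.trans_lt hc) (hmin.2 h).not_gt
  · rintro ⟨X, hX, hpos, hz, he⟩
    obtain ⟨c, hc⟩ := exists_isLeast_support he
    exact ⟨X, hX, hpos, ⟨c, not_le.1 fun h => hc.1 (hz c h), hc⟩, he⟩

theorem mem_posUnion_Ioi_iff_exists :
    e ∈ posUnion K (Set.Ioi a) ↔ ∃ b, a < b ∧ e ∈ posUnion K (Set.Ici b) := by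
  constructor
  · intro h
    obtain ⟨X, hX, hpos, hz, he⟩ := mem_posUnion_Ioi.1 h
    obtain ⟨c, hc⟩ := exists_isLeast_support he
    refine ⟨c, not_le.1 fun h => hc.1 (hz c h), mem_posUnion_Ici.2 ⟨X, hX, hpos, ?_, he⟩⟩
    intro f hf
    by_contra h
    exact absurd hf (hc.2 h).not_gt
  · rintro ⟨b, hab, h⟩
    obtain ⟨X, hX, hpos, hz, he⟩ := mem_posUnion_Ici.1 h
    exact mem_posUnion_Ioi.2 ⟨X, hX, hpos, fun f hf => hz f (hf.trans_lt hab), he⟩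

theorem mem_minPos : a ∈ minPos K ↔ a ∈ posUnion K (Set.Ici a) := by
  classical
  rw [minPos, Finset.mem_filter, mem_posUnion_Ici]
  constructor
  · rintro ⟨-, X, hX, hpos, hmin⟩
    refine ⟨X, hX, hpos, fun f hf => ?_, hmin.1⟩
    by_contra h
    exact absurd hf (hmin.2 h).not_gt
  · rintro ⟨X, hX, hpos, hz, ha⟩
    exact ⟨Finset.mem_univ _, X, hX, hpos, ha, fun f hf => not_lt.1 fun h => hf (hz f h)⟩

theorem self_mem_activePart (h : a ∈ minPos K) : a ∈ activePart K a := by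
  rw [activePart, Finset.mem_sdiff]
  refine ⟨mem_minPos.1 h, fun h' => ?_⟩
  obtain ⟨X, -, -, hz, ha⟩ := mem_posUnion_Ioi.1 h'
  exact ha (hz a le_rfl)

theorem eq_of_mem_activePart (ha : e ∈ activePart K a) (hb : e ∈ activePart K b) : a = b := by
  rw [activePart, Finset.mem_sdiff] at ha hb
  rcases lt_trichotomy a b with h | h | h
  · exact absurd (mem_posUnion_Ioi_iff_exists.2 ⟨b, h, hb.1⟩) ha.2
  · exact h
  · exact absurd (mem_posUnion_Ioi_iff_exists.2 ⟨a, h, ha.1⟩) hb.2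

theorem OrthogonalFamilies.notMem_posUnion (h : OrthogonalFamilies K L)
    (ha : e ∈ posUnion K (Set.Ici a)) : e ∉ posUnion L (Set.Ici b) := by
  intro hb
  obtain ⟨X, hX, hXpos, -, hXe⟩ := mem_posUnion_Ici.1 ha
  obtain ⟨Y, hY, hYpos, -, hYe⟩ := mem_posUnion_Ici.1 hb
  exact hXe (SignType.eq_zero_of_mul_eq_zero
    (h X hX Y hY (fun f => SignType.mul_nonneg' (hXpos f) (hYpos f)) e) hYe)

/-- Reorienting along a union of parts does not decrease the sets of the filtration. -/
theorem posUnion_subset_reorientFamily (h : IsDualPair K L)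
    (hW : ∀ a, activePart K a ⊆ W ∨ Disjoint (activePart K a) W) (a : E) :
    posUnion K (Set.Ici a) ⊆ posUnion (reorientFamily W K) (Set.Ici a) := by
  induction a using WellFoundedGT.induction with
  | _ a ih =>
    intro e he
    obtain ⟨X, hX, hpos, hz, hXe⟩ := mem_posUnion_Ici.1 he
    have hrK := h.reorientFamily W
    obtain ⟨Z, hZ, hZP, hZ0⟩ := exists_reorient_eq (K := reorientFamily W K) (X := X) (hW a)
      hrK.neg_left (reorient_mem_reorientFamily hX)
    rw [mem_posUnion_Ici]
    have hsub : posUnion K (Set.Ioi a) ⊆ posUnion (reorientFamily W K) (Set.Ioi a) := by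
      intro f hf
      obtain ⟨b, hab, hb⟩ := mem_posUnion_Ioi_iff_exists.1 hf
      exact mem_posUnion_Ioi_iff_exists.2 ⟨b, hab, ih b hab hb⟩
    have hT : ∀ f ∈ posUnion K (Set.Ioi a), ∃ Y ∈ reorientFamily W K, Y.IsPositive ∧
        (∀ g ∈ Set.Iio a, Y g = 0) ∧ Y f ≠ 0 := by
      intro f hf
      obtain ⟨Y, hY, hYpos, hYz, hYf⟩ := mem_posUnion_Ioi.1 (hsub hf)
      exact ⟨Y, hY, hYpos, fun g hg => hYz g (le_of_lt hg), hYf⟩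
    have hcover : ∀ f ∉ posUnion K (Set.Ioi a), X f = 0 ∨ f ∈ activePart K a := by
      intro f hf
      by_cases hXf : X f = 0
      · exact Or.inl hXf
      · exact Or.inr (Finset.mem_sdiff.2 ⟨mem_posUnion_Ici.2 ⟨X, hX, hpos, hz, hXf⟩, hf⟩)
    by_cases heT : e ∈ posUnion K (Set.Ioi a)
    · exact hT e heT
    refine exists_positive_of_nonneg_on_part hrK hZ (T := ↑(posUnion K (Set.Ioi a)))
      (fun f hf => hZ0 f (hz f hf)) hT (fun f hf => ?_) ?_
    · rcases hcover f hf with h0 | h0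
      · exact (hZ0 f h0).ge
      · rw [hZP f h0]
        exact hpos f
    · rw [hZP e ((hcover e heT).resolve_left hXe)]
      exact hXe

/-- Reorienting along a union of parts does not increase the sets of the filtration, provided that
the remaining reoriented elements lie in no positive member of the reoriented family. -/
theorem reorientFamily_posUnion_subset (h : IsDualPair K L)
    (hW : ∀ a, activePart K a ⊆ W ∨ Disjoint (activePart K a) W)
    (hcyc : ∀ X ∈ reorientFamily W K, X.IsPositive → ∀ e ∈ W, X e ≠ 0 →
      ∃ b, e ∈ posUnion K (Set.Ici b)) (a : E) :
    posUnion (reorientFamily W K) (Set.Ici a) ⊆ posUnion K (Set.Ici a) := by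
  intro e he
  obtain ⟨X, hX, hpos, hz, hXe⟩ := mem_posUnion_Ici.1 he
  have hXK : X.reorient W ∈ K := hX
  have hall : ∀ f, X f ≠ 0 → ∃ b, f ∈ posUnion K (Set.Ici b) := by
    intro f hf
    have hT : ∀ g ∈ {f | ∃ b, f ∈ posUnion K (Set.Ici b)}, ∃ Y ∈ K, Y.IsPositive ∧
        (∀ g ∈ (∅ : Set E), Y g = 0) ∧ Y g ≠ 0 := by
      rintro g ⟨b, hb⟩
      obtain ⟨Y, hY, hYpos, -, hYg⟩ := mem_posUnion_Ici.1 hb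
      exact ⟨Y, hY, hYpos, by simp, hYg⟩
    have hnn : ∀ g ∉ {f | ∃ b, f ∈ posUnion K (Set.Ici b)}, 0 ≤ X.reorient W g := by
      intro g hg
      by_cases hgW : g ∈ W
      · have hXg : X g = 0 := by_contra fun h => hg (hcyc X hX hpos g hgW h)
        exact (SignedSet.reorient_eq_zero_iff.2 hXg).ge
      · rw [SignedSet.reorient_of_notMem hgW]
        exact hpos g
    obtain ⟨Y, hY, hYpos, -, hYf⟩ := exists_positive_of_nonneg_on_part h hXK
      (fun f hf => absurd hf (Set.notMem_empty f)) hT hnn (SignedSet.reorient_eq_zero_iff.not.2 hf)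
    obtain ⟨c, hc⟩ := exists_isLeast_support hYf
    refine ⟨c, mem_posUnion_Ici.2 ⟨Y, hY, hYpos, fun g hg => ?_, hYf⟩⟩
    by_contra h
    exact absurd hg (hc.2 h).not_gt
  -- Let `b` be largest such that `X` is contained in the `b`-th set of the filtration.
  obtain ⟨b, hb, hmax⟩ := Set.exists_max_image
    {b | ∀ f, X f ≠ 0 → f ∈ posUnion K (Set.Ici b)} id (Set.toFinite _) (by
      obtain ⟨m, -, hm⟩ := Set.exists_min_image (Set.univ : Set E) id (Set.toFinite _)
        ⟨e, Set.mem_univ e⟩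
      refine ⟨m, fun f hf => ?_⟩
      obtain ⟨c, hc⟩ := hall f hf
      obtain ⟨Y, hY, hYpos, -, hYf⟩ := mem_posUnion_Ici.1 hc
      exact mem_posUnion_Ici.2 ⟨Y, hY, hYpos, fun g hg =>
        absurd hg (hm g (Set.mem_univ g)).not_gt, hYf⟩)
  by_cases hab : a ≤ b
  · obtain ⟨Y, hY, hYpos, hYz, hYe⟩ := mem_posUnion_Ici.1 (hb e hXe)
    exact mem_posUnion_Ici.2 ⟨Y, hY, hYpos, fun f hf => hYz f (hf.trans_le hab), hYe⟩
  rw [not_le] at hab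
  exfalso
  -- As `X` is zero up to `b`, it is even contained in the next set.
  have hnext : ∀ f, X f ≠ 0 → f ∈ posUnion K (Set.Ioi b) := by
    intro f hf
    obtain ⟨Z, hZ, hZP, hZ0⟩ := exists_reorient_eq (K := K) (X := X) (hW b) h.neg_left hXK
    by_cases hfT : f ∈ posUnion K (Set.Ioi b)
    · exact hfT
    rw [mem_posUnion_Ioi]
    refine exists_positive_of_nonneg_on_part h hZ (I := Set.Iic b)
      (T := ↑(posUnion K (Set.Ioi b))) (fun g hg => hZ0 g (hz g (lt_of_le_of_lt hg hab)))
      (fun g hg => mem_posUnion_Ioi.1 hg) (fun g hg => ?_) ?_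
    · by_cases hXg : X g = 0
      · exact (hZ0 g hXg).ge
      · rw [hZP g (Finset.mem_sdiff.2 ⟨hb g hXg, hg⟩)]
        exact hpos g
    · rw [hZP f (Finset.mem_sdiff.2 ⟨hb f hf, hfT⟩)]
      exact hf
  obtain ⟨c, hbc, hc⟩ := Set.exists_min_image (Set.Ioi b) id (Set.toFinite _) ⟨a, hab⟩
  refine absurd hbc (not_lt.2 (hmax c fun f hf => ?_))
  obtain ⟨d, hbd, hd⟩ := mem_posUnion_Ioi_iff_exists.1 (hnext f hf)
  obtain ⟨Y, hY, hYpos, hYz, hYf⟩ := mem_posUnion_Ici.1 hd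
  exact mem_posUnion_Ici.2 ⟨Y, hY, hYpos, fun g hg => hYz g (hg.trans_le (hc d hbd)), hYf⟩

/-- The union of the parts of `L` indexed by `P` and of the parts of `K` indexed by `Q`. -/
noncomputable def partUnion (K L : Set (SignedSet E)) (P Q : Finset E) : Finset E :=
  P.biUnion (activePart L) ∪ Q.biUnion (activePart K)

variable {P Q : Finset E}

theorem partUnion_swap (K L : Set (SignedSet E)) (P Q : Finset E) :
    partUnion K L P Q = partUnion L K Q P :=
  Finset.union_comm _ _

theorem mem_partUnion_iff (hKL : OrthogonalFamilies K L) (he : e ∈ activePart K a) :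
    e ∈ partUnion K L P Q ↔ a ∈ Q := by
  rw [partUnion, Finset.mem_union, Finset.mem_biUnion, Finset.mem_biUnion]
  constructor
  · rintro (⟨b, -, hb⟩ | ⟨b, hbQ, hb⟩)
    · exact absurd (Finset.mem_sdiff.1 hb).1 (hKL.notMem_posUnion (Finset.mem_sdiff.1 he).1)
    · rwa [eq_of_mem_activePart he hb]
  · exact fun h => Or.inr ⟨a, h, he⟩

theorem mem_partUnion_iff_right (hKL : OrthogonalFamilies K L) (he : e ∈ activePart L a) :
    e ∈ partUnion K L P Q ↔ a ∈ P := by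
  rw [partUnion_swap]
  exact mem_partUnion_iff hKL.symm he

theorem activePart_subset_or_disjoint (hKL : OrthogonalFamilies K L) (P Q : Finset E) (a : E) :
    activePart K a ⊆ partUnion K L P Q ∨ Disjoint (activePart K a) (partUnion K L P Q) := by
  by_cases h : a ∈ Q
  · exact Or.inl fun e he => (mem_partUnion_iff hKL he).2 h
  · exact Or.inr (Finset.disjoint_left.2 fun e he he' => h ((mem_partUnion_iff hKL he).1 he'))

/-- The filtration does not change when a union of parts is reoriented. A positive member of the
reoriented family avoids the parts of `L`, since these are still covered by positive members of
the reoriented family `L`. -/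
theorem posUnion_reorientFamily_partUnion (hK : IsDualPair K K') (hL : IsDualPair L L')
    (hKL : OrthogonalFamilies K L) (P Q : Finset E) (a : E) :
    posUnion (reorientFamily (partUnion K L P Q) K) (Set.Ici a) = posUnion K (Set.Ici a) := by
  refine (reorientFamily_posUnion_subset hK (activePart_subset_or_disjoint hKL P Q) ?_ a).antisymm
    (posUnion_subset_reorientFamily hK (activePart_subset_or_disjoint hKL P Q) a)
  intro X hX hpos e heW hXe
  rw [partUnion, Finset.mem_union, Finset.mem_biUnion, Finset.mem_biUnion] at heW
  rcases heW with ⟨b, -, hb⟩ | ⟨b, -, hb⟩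
  · exfalso
    have hLW : ∀ a, activePart L a ⊆ partUnion K L P Q ∨
        Disjoint (activePart L a) (partUnion K L P Q) := fun a => by
      rw [partUnion_swap]
      exact activePart_subset_or_disjoint hKL.symm Q P a
    have h1 := posUnion_subset_reorientFamily hL hLW b (Finset.mem_sdiff.1 hb).1
    obtain ⟨c, hc⟩ := exists_isLeast_support hXe
    refine (hKL.reorientFamily _).notMem_posUnion (a := c) (mem_posUnion_Ici.2
      ⟨X, hX, hpos, fun f hf => ?_, hXe⟩) h1
    by_contra h
    exact absurd hf (hc.2 h).not_gt
  · exact ⟨b, (Finset.mem_sdiff.1 hb).1⟩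

theorem posUnion_Ioi_congr (h : ∀ a, posUnion K (Set.Ici a) = posUnion L (Set.Ici a)) (a : E) :
    posUnion K (Set.Ioi a) = posUnion L (Set.Ioi a) := by
  ext e
  simp only [mem_posUnion_Ioi_iff_exists, h]

theorem activePart_congr (h : ∀ a, posUnion K (Set.Ici a) = posUnion L (Set.Ici a)) :
    activePart K = activePart L := by
  funext a
  rw [activePart, activePart, h, posUnion_Ioi_congr h]

theorem minPos_congr (h : ∀ a, posUnion K (Set.Ici a) = posUnion L (Set.Ici a)) :
    minPos K = minPos L := by
  ext a
  rw [mem_minPos, mem_minPos, h]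

theorem symmDiff_partUnion (hKL : OrthogonalFamilies K L) (P Q P' Q' : Finset E) :
    symmDiff (partUnion K L P Q) (partUnion K L P' Q') =
      partUnion K L (symmDiff P P') (symmDiff Q Q') := by
  ext e
  by_cases hK : ∃ a, e ∈ activePart K a
  · obtain ⟨a, ha⟩ := hK
    simp only [Finset.mem_symmDiff, mem_partUnion_iff hKL ha]
  by_cases hL : ∃ a, e ∈ activePart L a
  · obtain ⟨a, ha⟩ := hL
    simp only [Finset.mem_symmDiff, mem_partUnion_iff_right hKL ha]
  have hnot : ∀ P Q, e ∉ partUnion K L P Q := by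
    intro P Q he
    rw [partUnion, Finset.mem_union, Finset.mem_biUnion, Finset.mem_biUnion] at he
    rcases he with ⟨b, -, hb⟩ | ⟨b, -, hb⟩
    · exact hL ⟨b, hb⟩
    · exact hK ⟨b, hb⟩
  simp [Finset.mem_symmDiff, hnot]

theorem partUnion_inter_minPos (hKL : OrthogonalFamilies K L) (hQ : Q ⊆ minPos K) :
    partUnion K L P Q ∩ minPos K = Q := by
  ext a
  rw [Finset.mem_inter]
  constructor
  · rintro ⟨h1, h2⟩
    exact (mem_partUnion_iff hKL (self_mem_activePart h2)).1 h1
  · intro h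
    exact ⟨(mem_partUnion_iff hKL (self_mem_activePart (hQ h))).2 h, hQ h⟩

theorem partUnion_inter_minPos_right (hKL : OrthogonalFamilies K L) (hP : P ⊆ minPos L) :
    partUnion K L P Q ∩ minPos L = P := by
  rw [partUnion_swap]
  exact partUnion_inter_minPos hKL.symm hP

end Parts

/-! ### Activity classes -/

namespace OrientedMatroid

theorem symmDiff_subset {E : Type*} [DecidableEq E] {A B C : Finset E} (hA : A ⊆ C)
    (hB : B ⊆ C) : symmDiff A B ⊆ C := by
  intro e he
  rcases Finset.mem_symmDiff.1 he with h | h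
  · exact hA h.1
  · exact hB h.1

section Reorientation

variable {E : Type*} [DecidableEq E] {M N : OrientedMatroid E}

theorem reorient_reorient (M : OrientedMatroid E) (A B : Finset E) :
    (M.reorient A).reorient B = M.reorient (symmDiff A B) := by
  ext X
  change (X.reorient B).reorient A ∈ M.circuits ↔ X.reorient (symmDiff A B) ∈ M.circuits
  rw [SignedSet.reorient_reorient, symmDiff_comm]

theorem support_reorient (A : Finset E) (X : SignedSet E) :
    Function.support (X.reorient A) = Function.support X := by
  ext e
  exact SignedSet.reorient_eq_zero_iff.not

theorem toMatroid_reorient [Finite E] (M : OrientedMatroid E) (A : Finset E) :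
    (M.reorient A).toMatroid = M.toMatroid := by
  refine Matroid.ext_indep rfl fun I _ => ?_
  rw [toMatroid_indep_iff, toMatroid_indep_iff]
  constructor
  · intro h X hX
    rw [← support_reorient A]
    exact h _ (reorient_mem_reorientFamily (K := M.circuits) hX)
  · intro h X hX
    rw [← support_reorient A]
    exact h _ hX

theorem cocircuits_reorient [Finite E] (M : OrientedMatroid E) (A : Finset E) :
    (M.reorient A).cocircuits = reorientFamily A M.cocircuits := by
  have horth : ∀ X Y : SignedSet E, (X.reorient A).Orthogonal (Y.reorient A) ↔ X.Orthogonal Y :=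
    fun X Y => by simp only [SignedSet.Orthogonal, SignedSet.reorient_mul_reorient]
  ext Y
  change _ ∧ _ ↔ _ ∧ _
  rw [toMatroid_reorient, support_reorient]
  refine and_congr_right fun _ => ⟨fun h X hX => ?_, fun h X hX => ?_⟩
  · rw [← horth, SignedSet.reorient_reorient_self]
    exact h _ (reorient_mem_reorientFamily (K := M.circuits) hX)
  · rw [← horth]
    exact h _ hX

theorem numReorientations_eq_card {E : Type*} [Fintype E] (p : Finset E → Prop) [DecidablePred p] :
    numReorientations p = (Finset.univ.filter p).card := by
  rw [numReorientations, ← Set.ncard_coe_finset]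
  congr 1
  ext A
  simp

end Reorientation

section ActivityClasses

variable {E : Type*} [Fintype E] [LinearOrder E] {M N : OrientedMatroid E}
  {A B P Q : Finset E}

theorem IsPerspective.orthogonalFamilies_reorient (h : M.IsPerspective N) (A : Finset E) :
    OrthogonalFamilies (M.reorient A).circuits (N.reorient A).cocircuits := by
  rw [cocircuits_reorient]
  exact h.orthogonalFamilies.reorientFamily A

/-- The union of the acyclic parts indexed by `P` and of the cyclic parts indexed by `Q` of the
active partition of the reorientation along `A`. -/
noncomputable def activityUnion (M N : OrientedMatroid E) (A P Q : Finset E) : Finset E :=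
  partUnion (M.reorient A).circuits (N.reorient A).cocircuits P Q

theorem mem_activityClass : B ∈ M.activityClass N A ↔
    ∃ P ⊆ (N.reorient A).dualActive, ∃ Q ⊆ (M.reorient A).active,
      B = symmDiff A (activityUnion M N A P Q) :=
  Iff.rfl

theorem activityUnion_empty (M N : OrientedMatroid E) (A : Finset E) :
    activityUnion M N A ∅ ∅ = ∅ := rfl

theorem posUnion_circuits_symmDiff (hMN : M.IsPerspective N) (A P Q : Finset E) (a : E) :
    posUnion (M.reorient (symmDiff A (activityUnion M N A P Q))).circuits (Set.Ici a) =
      posUnion (M.reorient A).circuits (Set.Ici a) := by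
  rw [← reorient_reorient]
  exact posUnion_reorientFamily_partUnion (M.reorient A).isDualPair (N.reorient A).isDualPair.symm
    (hMN.orthogonalFamilies_reorient A) P Q a

theorem posUnion_cocircuits_symmDiff (hMN : M.IsPerspective N) (A P Q : Finset E) (a : E) :
    posUnion (N.reorient (symmDiff A (activityUnion M N A P Q))).cocircuits (Set.Ici a) =
      posUnion (N.reorient A).cocircuits (Set.Ici a) := by
  rw [← reorient_reorient, cocircuits_reorient, activityUnion, partUnion_swap]
  exact posUnion_reorientFamily_partUnion (N.reorient A).isDualPair.symm (M.reorient A).isDualPair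
    (hMN.orthogonalFamilies_reorient A).symm Q P a

theorem active_symmDiff (hMN : M.IsPerspective N) (A P Q : Finset E) :
    (M.reorient (symmDiff A (activityUnion M N A P Q))).active = (M.reorient A).active :=
  minPos_congr (posUnion_circuits_symmDiff hMN A P Q)

theorem dualActive_symmDiff (hMN : M.IsPerspective N) (A P Q : Finset E) :
    (N.reorient (symmDiff A (activityUnion M N A P Q))).dualActive = (N.reorient A).dualActive :=
  minPos_congr (posUnion_cocircuits_symmDiff hMN A P Q)

theorem activityUnion_symmDiff (hMN : M.IsPerspective N) (A P Q P' Q' : Finset E) :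
    activityUnion M N (symmDiff A (activityUnion M N A P Q)) P' Q' = activityUnion M N A P' Q' := by
  rw [activityUnion, partUnion, activePart_congr (posUnion_circuits_symmDiff hMN A P Q),
    activePart_congr (posUnion_cocircuits_symmDiff hMN A P Q)]
  rfl

theorem symmDiff_activityUnion (hMN : M.IsPerspective N) (A P Q P' Q' : Finset E) :
    symmDiff (activityUnion M N A P Q) (activityUnion M N A P' Q') =
      activityUnion M N A (symmDiff P P') (symmDiff Q Q') :=
  symmDiff_partUnion (hMN.orthogonalFamilies_reorient A) P Q P' Q'

/-- Among the active elements, reorienting the parts indexed by `Q` changes exactly those in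
`Q`. -/
theorem active_inter_symmDiff (hMN : M.IsPerspective N) (hQ : Q ⊆ (M.reorient A).active) :
    (M.reorient A).active ∩ symmDiff A (activityUnion M N A P Q) =
      symmDiff ((M.reorient A).active ∩ A) Q := by
  rw [← Finset.inf_eq_inter, inf_symmDiff_distrib_left, Finset.inf_eq_inter, Finset.inf_eq_inter,
    Finset.inter_comm _ (activityUnion M N A P Q)]
  congr 1
  exact partUnion_inter_minPos (hMN.orthogonalFamilies_reorient A) hQ

theorem dualActive_inter_symmDiff (hMN : M.IsPerspective N) (hP : P ⊆ (N.reorient A).dualActive) :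
    (N.reorient A).dualActive ∩ symmDiff A (activityUnion M N A P Q) =
      symmDiff ((N.reorient A).dualActive ∩ A) P := by
  rw [← Finset.inf_eq_inter, inf_symmDiff_distrib_left, Finset.inf_eq_inter, Finset.inf_eq_inter,
    Finset.inter_comm _ (activityUnion M N A P Q)]
  congr 1
  exact partUnion_inter_minPos_right (hMN.orthogonalFamilies_reorient A) hP

/-- The representative of the activity class of `A` in which no active and no dual-active element
is reoriented. -/
noncomputable def fixedRep (M N : OrientedMatroid E) (A : Finset E) : Finset E :=
  symmDiff A (activityUnion M N A ((N.reorient A).dualActive ∩ A) ((M.reorient A).active ∩ A))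

theorem activeFixed_fixedRep (hMN : M.IsPerspective N) (A : Finset E) :
    M.ActiveFixed (fixedRep M N A) := by
  rw [ActiveFixed, fixedRep, active_symmDiff hMN, active_inter_symmDiff hMN
    Finset.inter_subset_left, symmDiff_self]
  rfl

theorem dualActiveFixed_fixedRep (hMN : M.IsPerspective N) (A : Finset E) :
    N.DualActiveFixed (fixedRep M N A) := by
  rw [DualActiveFixed, fixedRep, dualActive_symmDiff hMN, dualActive_inter_symmDiff hMN
    Finset.inter_subset_left, symmDiff_self]
  rfl

theorem active_fixedRep (hMN : M.IsPerspective N) (A : Finset E) :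
    (M.reorient (fixedRep M N A)).active = (M.reorient A).active :=
  active_symmDiff hMN _ _ _

theorem dualActive_fixedRep (hMN : M.IsPerspective N) (A : Finset E) :
    (N.reorient (fixedRep M N A)).dualActive = (N.reorient A).dualActive :=
  dualActive_symmDiff hMN _ _ _

theorem fixedRep_symmDiff (hMN : M.IsPerspective N) (hA : M.ActiveFixed A)
    (hA' : N.DualActiveFixed A) (hP : P ⊆ (N.reorient A).dualActive)
    (hQ : Q ⊆ (M.reorient A).active) :
    fixedRep M N (symmDiff A (activityUnion M N A P Q)) = A := by
  rw [fixedRep, active_symmDiff hMN, dualActive_symmDiff hMN, active_inter_symmDiff hMN hQ,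
    dualActive_inter_symmDiff hMN hP, hA, hA', activityUnion_symmDiff hMN]
  change symmDiff (symmDiff A _) (activityUnion M N A (symmDiff ⊥ P) (symmDiff ⊥ Q)) = A
  rw [bot_symmDiff, bot_symmDiff, symmDiff_symmDiff_cancel_right]

theorem self_mem_activityClass (M N : OrientedMatroid E) (A : Finset E) :
    A ∈ M.activityClass N A :=
  mem_activityClass.2 ⟨∅, Finset.empty_subset _, ∅, Finset.empty_subset _, by
    rw [activityUnion_empty]
    exact (symmDiff_bot A).symm⟩

theorem fixedRep_mem_activityClass (M N : OrientedMatroid E) (A : Finset E) :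
    fixedRep M N A ∈ M.activityClass N A :=
  mem_activityClass.2 ⟨_, Finset.inter_subset_left, _, Finset.inter_subset_left, rfl⟩

theorem activityClass_eq_of_mem (hMN : M.IsPerspective N) (hB : B ∈ M.activityClass N A) :
    M.activityClass N B = M.activityClass N A := by
  obtain ⟨P, hP, Q, hQ, rfl⟩ := mem_activityClass.1 hB
  ext C
  rw [mem_activityClass, mem_activityClass, active_symmDiff hMN, dualActive_symmDiff hMN]
  constructor
  · rintro ⟨P', hP', Q', hQ', rfl⟩
    refine ⟨_, symmDiff_subset hP hP', _, symmDiff_subset hQ hQ', ?_⟩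
    rw [activityUnion_symmDiff hMN, symmDiff_assoc, symmDiff_activityUnion hMN]
  · rintro ⟨P', hP', Q', hQ', rfl⟩
    refine ⟨_, symmDiff_subset hP hP', _, symmDiff_subset hQ hQ', ?_⟩
    rw [activityUnion_symmDiff hMN, symmDiff_assoc, symmDiff_activityUnion hMN,
      symmDiff_symmDiff_cancel_left, symmDiff_symmDiff_cancel_left]

theorem eq_of_mem_activityClass (hMN : M.IsPerspective N) (hA : M.ActiveFixed A)
    (hA' : N.DualActiveFixed A) (hB : M.ActiveFixed B) (hB' : N.DualActiveFixed B)
    (h : B ∈ M.activityClass N A) : B = A := by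
  obtain ⟨P, hP, Q, hQ, rfl⟩ := mem_activityClass.1 h
  rw [ActiveFixed, active_symmDiff hMN, active_inter_symmDiff hMN hQ, hA] at hB
  rw [DualActiveFixed, dualActive_symmDiff hMN, dualActive_inter_symmDiff hMN hP, hA'] at hB'
  have hQ0 : Q = ∅ := by
    rw [← hB]
    exact (bot_symmDiff Q).symm
  have hP0 : P = ∅ := by
    rw [← hB']
    exact (bot_symmDiff P).symm
  rw [hQ0, hP0, activityUnion_empty]
  exact symmDiff_bot A

end ActivityClasses

/-! ### Counting reorientations and classes -/

section Counting

variable {E : Type*} [Fintype E] [LinearOrder E] {M N : OrientedMatroid E} {R : Type*} [CommRing R]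

open Classical in
/-- The reorientations that are both active-fixed and dual-active-fixed. -/
noncomputable def fixedReorientations (M N : OrientedMatroid E) : Finset (Finset E) :=
  {A | M.ActiveFixed A ∧ N.DualActiveFixed A}

theorem mem_fixedReorientations {A : Finset E} :
    A ∈ fixedReorientations M N ↔ M.ActiveFixed A ∧ N.DualActiveFixed A := by
  simp [fixedReorientations]

/-- Each reorientation is obtained from exactly one fixed reorientation by reorienting parts of its
active partition, and the indices of these parts are the reoriented active and dual-active
elements. -/
theorem sum_reorientations {T : Type*} [AddCommMonoid T] (hMN : M.IsPerspective N)
    (f : Finset E → Finset E → Finset E → Finset E → T) :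
    ∑ A : Finset E, f (N.reorient A).dualActive (M.reorient A).active
        ((N.reorient A).dualActive ∩ A) ((M.reorient A).active ∩ A) =
      ∑ A ∈ fixedReorientations M N, ∑ p ∈ (N.reorient A).dualActive.powerset ×ˢ
        (M.reorient A).active.powerset,
        f (N.reorient A).dualActive (M.reorient A).active p.1 p.2 := by
  rw [Finset.sum_sigma']
  refine Finset.sum_bij'
    (i := fun A _ => ⟨fixedRep M N A, (N.reorient A).dualActive ∩ A, (M.reorient A).active ∩ A⟩)
    (j := fun x _ => symmDiff x.1 (activityUnion M N x.1 x.2.1 x.2.2)) ?_ ?_ ?_ ?_ ?_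
  · intro A _
    simp only [Finset.mem_sigma, Finset.mem_product, Finset.mem_powerset, mem_fixedReorientations,
      active_fixedRep hMN, dualActive_fixedRep hMN]
    exact ⟨⟨activeFixed_fixedRep hMN A, dualActiveFixed_fixedRep hMN A⟩,
      Finset.inter_subset_left, Finset.inter_subset_left⟩
  · intro x _
    exact Finset.mem_univ _
  · intro A _
    change symmDiff (fixedRep M N A) (activityUnion M N (fixedRep M N A) _ _) = A
    rw [fixedRep, activityUnion_symmDiff hMN, symmDiff_symmDiff_cancel_right]
  · rintro ⟨A, P, Q⟩ hx
    simp only [Finset.mem_sigma, Finset.mem_product, Finset.mem_powerset,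
      mem_fixedReorientations] at hx
    obtain ⟨⟨hA, hA'⟩, hP, hQ⟩ := hx
    have h1 : (∅ : Finset E) = ⊥ := rfl
    simp only [fixedRep_symmDiff hMN hA hA' hP hQ, active_symmDiff hMN, dualActive_symmDiff hMN,
      active_inter_symmDiff hMN hQ, dualActive_inter_symmDiff hMN hP]
    rw [hA, hA', h1, bot_symmDiff, bot_symmDiff]
  · intro A _
    simp only [active_fixedRep hMN, dualActive_fixedRep hMN]

theorem sum_pow_eq_sum_fixedReorientations (hMN : M.IsPerspective N) (u v : R) :
    ∑ A : Finset E, u ^ (N.reorient A).dualActive.card * v ^ (M.reorient A).active.card =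
      ∑ A ∈ fixedReorientations M N,
        (2 * u) ^ (N.reorient A).dualActive.card * (2 * v) ^ (M.reorient A).active.card := by
  rw [sum_reorientations hMN fun O' O _ _ => u ^ O'.card * v ^ O.card]
  refine Finset.sum_congr rfl fun A _ => ?_
  rw [Finset.sum_const, Finset.card_product, Finset.card_powerset, Finset.card_powerset,
    nsmul_eq_mul]
  push_cast
  ring

/-- Counting reorientations by a condition `p` on the dual-active elements and those among them that
are reoriented, and a condition `q` on the active elements and those that are reoriented. -/
theorem sum_fixedReorientations_eq_numReorientations (hMN : M.IsPerspective N) (x y : ℕ)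
    (p q : Finset E → Finset E → Prop) [∀ O, DecidablePred (p O)] [∀ O, DecidablePred (q O)]
    (hp : ∀ O : Finset E, (O.powerset.filter (p O)).card = x ^ O.card)
    (hq : ∀ O : Finset E, (O.powerset.filter (q O)).card = y ^ O.card) :
    ∑ A ∈ fixedReorientations M N,
        x ^ (N.reorient A).dualActive.card * y ^ (M.reorient A).active.card =
      numReorientations fun A : Finset E =>
        p (N.reorient A).dualActive ((N.reorient A).dualActive ∩ A) ∧
          q (M.reorient A).active ((M.reorient A).active ∩ A) := by
  rw [numReorientations_eq_card, Finset.card_filter,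
    sum_reorientations hMN fun O' O P Q => if p O' P ∧ q O Q then 1 else 0]
  refine Finset.sum_congr rfl fun A _ => ?_
  rw [← Finset.card_filter, ← hp, ← hq, ← Finset.card_product, Finset.filter_product]

/-- The activity classes in which all members have a property that is constant on classes are
counted by their fixed members. -/
theorem numClasses_eq_card (hMN : M.IsPerspective N) (p : Finset E → Prop) [DecidablePred p]
    (hp : ∀ A, ∀ B ∈ M.activityClass N A, p A → p B) :
    M.numClasses N p = ((fixedReorientations M N).filter p).card := by
  have himage : {K ∈ M.activityClasses N | ∀ A ∈ K, p A} =
      M.activityClass N '' ↑((fixedReorientations M N).filter p) := by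
    ext K
    constructor
    · rintro ⟨⟨A, rfl⟩, hA⟩
      have hrep := fixedRep_mem_activityClass M N A
      refine ⟨fixedRep M N A, ?_, activityClass_eq_of_mem hMN hrep⟩
      rw [Finset.mem_coe, Finset.mem_filter, mem_fixedReorientations]
      exact ⟨⟨activeFixed_fixedRep hMN A, dualActiveFixed_fixedRep hMN A⟩, hA _ hrep⟩
    · rintro ⟨A, hA, rfl⟩
      rw [Finset.mem_coe, Finset.mem_filter] at hA
      exact ⟨⟨A, rfl⟩, fun B hB => hp A B hB hA.2⟩
  rw [numClasses, himage, Set.InjOn.ncard_image, Set.ncard_coe_finset]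
  intro A hA B hB hAB
  rw [Finset.mem_coe, Finset.mem_filter, mem_fixedReorientations] at hA hB
  refine eq_of_mem_activityClass hMN hB.1.1 hB.1.2 hA.1.1 hA.1.2 ?_
  rw [← show M.activityClass N A = M.activityClass N B from hAB]
  exact self_mem_activityClass M N A

theorem active_eq_of_mem_activityClass (hMN : M.IsPerspective N) {A B : Finset E}
    (h : B ∈ M.activityClass N A) : (M.reorient B).active = (M.reorient A).active := by
  obtain ⟨P, -, Q, -, rfl⟩ := mem_activityClass.1 h
  exact active_symmDiff hMN A P Q

theorem dualActive_eq_of_mem_activityClass (hMN : M.IsPerspective N) {A B : Finset E}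
    (h : B ∈ M.activityClass N A) : (N.reorient B).dualActive = (N.reorient A).dualActive := by
  obtain ⟨P, -, Q, -, rfl⟩ := mem_activityClass.1 h
  exact dualActive_symmDiff hMN A P Q

theorem isAcyclic_iff (M : OrientedMatroid E) : M.IsAcyclic ↔ M.active = ∅ := by
  rw [Finset.eq_empty_iff_forall_notMem]
  constructor
  · intro h a ha
    obtain ⟨X, hX, hpos, -⟩ := mem_posUnion_Ici.1 (mem_minPos.1 ha)
    exact h X hX hpos
  · intro h X hX hpos
    have hX0 : X ≠ 0 := fun h0 => M.zero_notMem (h0 ▸ hX)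
    obtain ⟨e, he⟩ := Function.ne_iff.1 hX0
    obtain ⟨a, ha⟩ := exists_isLeast_support (X := X) he
    refine h a (mem_minPos.2 (mem_posUnion_Ici.2 ⟨X, hX, hpos, fun f hf => ?_, ha.1⟩))
    by_contra h0
    exact absurd hf (ha.2 h0).not_gt

theorem isTotallyCyclic_iff (N : OrientedMatroid E) :
    N.IsTotallyCyclic ↔ N.dualActive = ∅ := by
  rw [Finset.eq_empty_iff_forall_notMem]
  constructor
  · intro h a ha
    obtain ⟨Y, hY, hYpos, -, hYa⟩ := mem_posUnion_Ici.1 (mem_minPos.1 ha)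
    obtain ⟨X, hX, hXpos, hXa⟩ := h a
    exact hXa (SignType.eq_zero_of_mul_eq_zero (N.isDualPair.orth X hX Y hY
      (fun f => SignType.mul_nonneg' (hXpos f) (hYpos f)) a) hYa)
  · intro h e
    rcases N.isDualPair.painting (fun _ => 1) ∅ e (by decide) with
      ⟨X, hX, hXe, hXpos, -⟩ | ⟨Y, hY, hYe, hYpos, -⟩
    · exact ⟨X, hX, fun f => by simpa using hXpos f, by simp [hXe]⟩
    · exfalso
      obtain ⟨a, ha⟩ := exists_isLeast_support (X := Y) (e := e) (by simp [hYe])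
      refine h a (mem_minPos.2 (mem_posUnion_Ici.2 ⟨Y, hY, fun f => by simpa using hYpos f,
        fun f hf => ?_, ha.1⟩))
      by_contra h0
      exact absurd hf (ha.2 h0).not_gt

end Counting

end OrientedMatroid

/-! ### The Tutte polynomial -/

namespace OrientedMatroid

section Powerset

variable {α : Type*} [DecidableEq α]

theorem card_powerset_filter_true {α : Type*} (O : Finset α) :
    (O.powerset.filter fun _ => True).card = 2 ^ O.card := by
  simp

theorem card_powerset_filter_eq_empty (O : Finset α) :
    (O.powerset.filter fun P => P = ∅).card = 1 ^ O.card := by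
  rw [one_pow, Finset.card_eq_one]
  refine ⟨∅, ?_⟩
  ext P
  simp only [Finset.mem_filter, Finset.mem_powerset, Finset.mem_singleton, and_iff_right_iff_imp]
  rintro rfl
  exact Finset.empty_subset _

theorem ite_eq_empty (O : Finset α) : (if O = ∅ then 1 else 0) = 0 ^ O.card := by
  by_cases h : O = ∅
  · simp [h]
  · rw [if_neg h, zero_pow (Finset.card_ne_zero.2 (Finset.nonempty_iff_ne_empty.2 h))]

theorem card_powerset_filter_const (O : Finset α) :
    (O.powerset.filter fun _ => O = ∅).card = 0 ^ O.card := by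
  rw [← ite_eq_empty]
  by_cases h : O = ∅ <;> simp [h]

end Powerset

section Expansion

variable {E : Type*} [Fintype E] [LinearOrder E] {M N : OrientedMatroid E}

theorem activeIn_univ (K : Set (SignedSet E)) (A : Finset E) :
    activeIn K Finset.univ ∅ A = minPos (reorientFamily A K) := by
  ext a
  rw [mem_activeIn, mem_minPos, mem_posUnion_Ici]
  constructor
  · rintro ⟨-, X, hX, hXa⟩
    exact ⟨X.reorient A, reorient_mem_reorientFamily hX, fun e => hXa.nonneg e (Finset.mem_univ e),
      fun e he => SignedSet.reorient_eq_zero_iff.2 (hXa.eq_zero_of_lt e (Finset.mem_univ e) he),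
      SignedSet.reorient_eq_zero_iff.not.2 hXa.ne_zero⟩
  · rintro ⟨X, hX, hpos, hz, ha⟩
    refine ⟨Finset.mem_univ a, X.reorient A, hX, SignedSet.reorient_eq_zero_iff.not.2 ha,
      fun e _ => ?_, fun e _ he => SignedSet.reorient_eq_zero_iff.2 (hz e he),
      fun e he => absurd (Finset.mem_univ e) he⟩
    rw [SignedSet.reorient_reorient_self]
    exact hpos e

theorem activitySum_univ {R : Type*} [CommRing R] (M N : OrientedMatroid E) (u v : R) :
    activitySum M.circuits N.cocircuits Finset.univ ∅ ∅ u v =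
      ∑ A : Finset E, u ^ (N.reorient A).dualActive.card * v ^ (M.reorient A).active.card := by
  rw [activitySum, Finset.powerset_univ]
  refine Finset.sum_congr rfl fun A _ => ?_
  rw [activeIn_univ, activeIn_univ, ← cocircuits_reorient]
  rfl

theorem map_tutteSum {R R' : Type*} [CommRing R] [CommRing R'] (φ : R →+* R') (S C : Finset E)
    (x y : R) : φ (tutteSum M N S C x y) = tutteSum M N S C (φ x) (φ y) := by
  simp [tutteSum]

theorem tuttePolynomialOne_eq_tutteSum (M N : OrientedMatroid E) :
    M.tuttePolynomialOne N =
      tutteSum M N Finset.univ ∅ (MvPolynomial.X 0) (MvPolynomial.X 1) := by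
  have h0 : M.rk ∅ = 0 := by simp [rk]
  simp [tuttePolynomialOne, tuttePolynomial, tutteSum, h0]

/-- The polynomial `t(M,N;x,y,1)` counts the fixed reorientations by their activities. Over `ℚ`,
the variables can be written as twice another element. -/
theorem tuttePolynomialOne_eq (hMN : M.IsPerspective N) :
    M.tuttePolynomialOne N = ∑ A ∈ fixedReorientations M N,
      (MvPolynomial.X 0 : MvPolynomial (Fin 2) ℤ) ^ (N.reorient A).dualActive.card *
        MvPolynomial.X 1 ^ (M.reorient A).active.card := by
  refine MvPolynomial.map_injective (Int.castRingHom ℚ) Int.cast_injective ?_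
  have hhalf : ∀ i : Fin 2, (MvPolynomial.X i : MvPolynomial (Fin 2) ℚ) =
      2 * (MvPolynomial.C (1 / 2) * MvPolynomial.X i) := by
    intro i
    rw [← mul_assoc, show (2 : MvPolynomial (Fin 2) ℚ) = MvPolynomial.C 2 from
      (map_ofNat MvPolynomial.C 2).symm, ← MvPolynomial.C_mul]
    norm_num
  rw [tuttePolynomialOne_eq_tutteSum, map_tutteSum, map_sum, MvPolynomial.map_X,
    MvPolynomial.map_X, hhalf 0, hhalf 1,
    tutteSum_two_mul hMN _ _ Finset.univ ∅ ∅ (Finset.disjoint_empty_right _)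
      (Finset.disjoint_empty_right _) (Finset.disjoint_empty_right _)
      (fun e he => absurd (Finset.mem_univ e) he),
    activitySum_univ, sum_pow_eq_sum_fixedReorientations hMN, ← hhalf, ← hhalf]
  simp

theorem tutteCoeff_eq (hMN : M.IsPerspective N) (i j : ℕ) :
    M.tutteCoeff N i j = ((fixedReorientations M N).filter fun A =>
      (N.reorient A).dualActive.card = i ∧ (M.reorient A).active.card = j).card := by
  have hmono : ∀ a b : ℕ, (MvPolynomial.X 0 ^ a * MvPolynomial.X 1 ^ b :
      MvPolynomial (Fin 2) ℤ).coeff (Finsupp.single 0 i + Finsupp.single 1 j) =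
        if a = i ∧ b = j then 1 else 0 := by
    intro a b
    rw [MvPolynomial.X_pow_eq_monomial, MvPolynomial.X_pow_eq_monomial,
      MvPolynomial.monomial_mul, MvPolynomial.coeff_monomial, mul_one]
    refine if_congr ?_ rfl rfl
    constructor
    · intro h
      exact ⟨by simpa using DFunLike.congr_fun h 0, by simpa using DFunLike.congr_fun h 1⟩
    · rintro ⟨rfl, rfl⟩
      rfl
  rw [tutteCoeff, tuttePolynomialOne_eq hMN, MvPolynomial.coeff_sum, Finset.card_filter]
  push_cast
  exact Finset.sum_congr rfl fun A _ => hmono _ _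

theorem tutteEval_eq (hMN : M.IsPerspective N) (x y : ℕ) :
    M.tutteEval N x y 1 = ((∑ A ∈ fixedReorientations M N,
      x ^ (N.reorient A).dualActive.card * y ^ (M.reorient A).active.card : ℕ) : ℤ) := by
  have h : M.tutteEval N x y 1 =
      MvPolynomial.eval ![(x : ℤ), (y : ℤ)] (M.tuttePolynomialOne N) := by
    simp [tutteEval, tuttePolynomialOne, tuttePolynomial]
  rw [h, tuttePolynomialOne_eq hMN]
  simp

/-- Evaluations at which both variables are at most `1` count the fixed reorientations with a
condition on their activities, hence activity classes. The conditions are `True` for the value `1`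
and `O = ∅` for the value `0`. -/
theorem tutteEval_eq_numClasses (hMN : M.IsPerspective N) (x y : ℕ)
    (p q : Finset E → Prop) [DecidablePred p] [DecidablePred q]
    (hp : ∀ O : Finset E, (if p O then 1 else 0) = x ^ O.card)
    (hq : ∀ O : Finset E, (if q O then 1 else 0) = y ^ O.card) :
    M.tutteEval N x y 1 =
      M.numClasses N fun A => q (M.reorient A).active ∧ p (N.reorient A).dualActive := by
  rw [tutteEval_eq hMN, numClasses_eq_card hMN _ (fun A B hB h => by
    rwa [active_eq_of_mem_activityClass hMN hB, dualActive_eq_of_mem_activityClass hMN hB]),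
    Finset.card_filter]
  congr 1
  refine Finset.sum_congr rfl fun A _ => ?_
  rw [← hp, ← hq]
  split_ifs <;> simp_all

/-- The conditions for the values `2`, `1`, `0` of a variable are no condition, no reoriented active
(or dual-active) element, and no active (or dual-active) element; see `card_powerset_filter_true`,
`card_powerset_filter_eq_empty` and `card_powerset_filter_const`. -/
theorem tutteEval_eq_numReorientations (hMN : M.IsPerspective N) (x y : ℕ)
    (p q : Finset E → Finset E → Prop) [∀ O, DecidablePred (p O)] [∀ O, DecidablePred (q O)]
    (hp : ∀ O : Finset E, (O.powerset.filter (p O)).card = x ^ O.card)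
    (hq : ∀ O : Finset E, (O.powerset.filter (q O)).card = y ^ O.card) :
    M.tutteEval N x y 1 = numReorientations fun A : Finset E =>
      p (N.reorient A).dualActive ((N.reorient A).dualActive ∩ A) ∧
        q (M.reorient A).active ((M.reorient A).active ∩ A) := by
  rw [tutteEval_eq hMN, sum_fixedReorientations_eq_numReorientations hMN x y p q hp hq]

end Expansion

end OrientedMatroid

theorem mainTheorem5 {E : Type*} [Fintype E] [LinearOrder E] (M N : OrientedMatroid E)
    (hMN : M.IsPerspective N) :
    (∀ i j : ℕ,
      M.tutteCoeff N i j = M.numClasses N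
        (fun A => (N.reorient A).dualActive.card = i ∧ (M.reorient A).active.card = j) ∧
      M.tutteCoeff N i j = OrientedMatroid.numReorientations
        (fun A : Finset E => (N.reorient A).dualActive.card = i ∧ (M.reorient A).active.card = j ∧
          M.ActiveFixed A ∧ N.DualActiveFixed A)) ∧
    (M.tutteEval N 2 2 1 = OrientedMatroid.numReorientations (fun _ : Finset E => True)) ∧
    (M.tutteEval N 2 0 1 = OrientedMatroid.numReorientations
      (fun A : Finset E => (M.reorient A).IsAcyclic)) ∧
    (M.tutteEval N 0 2 1 = OrientedMatroid.numReorientations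
      (fun A : Finset E => (N.reorient A).IsTotallyCyclic)) ∧
    (M.tutteEval N 1 0 1 = OrientedMatroid.numReorientations
        (fun A : Finset E => (M.reorient A).IsAcyclic ∧ N.DualActiveFixed A) ∧
      M.tutteEval N 1 0 1 = M.numClasses N (fun A => (M.reorient A).IsAcyclic)) ∧
    (M.tutteEval N 0 1 1 = OrientedMatroid.numReorientations
        (fun A : Finset E => M.ActiveFixed A ∧ (N.reorient A).IsTotallyCyclic) ∧
      M.tutteEval N 0 1 1 = M.numClasses N (fun A => (N.reorient A).IsTotallyCyclic)) ∧
    (M.tutteEval N 2 1 1 = OrientedMatroid.numReorientations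
      (fun A : Finset E => M.ActiveFixed A)) ∧
    (M.tutteEval N 1 2 1 = OrientedMatroid.numReorientations
      (fun A : Finset E => N.DualActiveFixed A)) ∧
    (M.tutteEval N 1 1 1 = OrientedMatroid.numReorientations
        (fun A : Finset E => M.ActiveFixed A ∧ N.DualActiveFixed A) ∧
      M.tutteEval N 1 1 1 = (M.activityClasses N).ncard) ∧
    (M.tutteEval N 0 0 1 = OrientedMatroid.numReorientations
        (fun A : Finset E => (M.reorient A).IsAcyclic ∧ (N.reorient A).IsTotallyCyclic) ∧
      M.tutteEval N 0 0 1 = M.numClasses N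
        (fun A => (M.reorient A).IsAcyclic ∧ (N.reorient A).IsTotallyCyclic)) := by
  classical
  have hA : ∀ A, (M.reorient A).IsAcyclic ↔ (M.reorient A).active = ∅ := fun A =>
    OrientedMatroid.isAcyclic_iff _
  have hT : ∀ A, (N.reorient A).IsTotallyCyclic ↔ (N.reorient A).dualActive = ∅ := fun A =>
    OrientedMatroid.isTotallyCyclic_iff _
  have hR := OrientedMatroid.tutteEval_eq_numReorientations hMN
  have hC := OrientedMatroid.tutteEval_eq_numClasses hMN
  have h2 := OrientedMatroid.card_powerset_filter_true (α := E)
  have h1 := OrientedMatroid.card_powerset_filter_eq_empty (α := E)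
  have h0 := OrientedMatroid.card_powerset_filter_const (α := E)
  have c1 : ∀ O : Finset E, (if True then 1 else 0) = 1 ^ O.card := fun O => by simp
  have c0 := OrientedMatroid.ite_eq_empty (α := E)
  refine ⟨fun i j => ⟨?_, ?_⟩, ?_, ?_, ?_, ⟨?_, ?_⟩, ⟨?_, ?_⟩, ?_, ?_, ⟨?_, ?_⟩, ⟨?_, ?_⟩⟩
  · rw [OrientedMatroid.tutteCoeff_eq hMN, OrientedMatroid.numClasses_eq_card hMN]
    intro A B hB h
    rwa [OrientedMatroid.active_eq_of_mem_activityClass hMN hB,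
      OrientedMatroid.dualActive_eq_of_mem_activityClass hMN hB]
  · rw [OrientedMatroid.tutteCoeff_eq hMN, OrientedMatroid.numReorientations_eq_card]
    congr 2
    ext A
    simp only [Finset.mem_filter, Finset.mem_univ, true_and,
      OrientedMatroid.mem_fixedReorientations]
    tauto
  · simpa using hR 2 2 _ _ h2 h2
  · simpa [hA] using hR 2 0 _ _ h2 h0
  · simpa [hT] using hR 0 2 _ _ h0 h2
  · simpa [hA, OrientedMatroid.DualActiveFixed, and_comm] using hR 1 0 _ _ h1 h0
  · simpa [hA] using hC 1 0 _ _ c1 c0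
  · simpa [hT, OrientedMatroid.ActiveFixed, and_comm] using hR 0 1 _ _ h0 h1
  · simpa [hT] using hC 0 1 _ _ c0 c1
  · simpa [OrientedMatroid.ActiveFixed] using hR 2 1 _ _ h2 h1
  · simpa [OrientedMatroid.DualActiveFixed] using hR 1 2 _ _ h1 h2
  · simpa [OrientedMatroid.ActiveFixed, OrientedMatroid.DualActiveFixed, and_comm] using
      hR 1 1 _ _ h1 h1
  · simpa [OrientedMatroid.numClasses] using hC 1 1 _ _ c1 c1
  · simpa [hA, hT, and_comm] using hR 0 0 _ _ h0 h0
  · simpa [hA, hT] using hC 0 0 _ _ c0 c0
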